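/- Let $d$ be a positive integer. Let $\mathcal T$ be a metric space, and for every $t\in\mathcal T$ let $\mathcal A_t$ be a unital C*-algebra and $\xi_t=(\xi_{t,1},\dots,\xi_{t,d})\in\mathcal A_t^d$ a $d$-tuple generating $\mathcal A_t$ as a unital C*-algebra. Notation. $\mathbb C\langle z,z^*\rangle$ is the algebra of $*$-polynomials in noncommuting variables $z_1,\dots,z_d$, that is, the free unital algebra on $z_1,\dots,z_d,z_1^*,\dots,z_d^*$; $\mathbb C_1\langle z,z^*\rangle$ is the linear span of $1,z_1,\dots,z_d,z_1^*,\dots,z_d^*$. For $p\in\mathbb C\langle z,z^*\rangle$, $p(\xi_t)\in\mathcal A_t$ is obtained by substituting $\xi_{t,i}$ for $z_i$ and the adjoint of $\xi_{t,i}$ for $z_i^*$; an $n\times n$ matrix $p\in M_n(\mathbb C\langle z,z^*\rangle)$ is evaluated entrywise to $p(\xi_t)$ in the C*-algebra $M_n(\mathcal A_t)$. For $n\ge 1$, $\mathcal W_n(\xi_t)\subseteq M_n(\mathbb C)^d$ is the set of all tuples $(\phi(\xi_{t,1}),\dots,\phi(\xi_{t,d}))$, where $\phi\colon\mathcal A_t\to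 M_n(\mathbb C)$ is a unital completely positive map. On $M_n(\mathbb C)^d$ put $\|X\|=\|\sum_i X_iX_i^*\|^{1/2}$ (operator norm on the right), $d(X,Y)=\|X-Y\|$, and let $$d_H(E,F)=\max\Bigl\{\sup_{x\in E}\inf_{y\in F}d(x,y),\ \sup_{y\in F}\inf_{x\in E}d(x,y)\Bigr\}$$ be the Hausdorff distance. For $t_0\in\mathcal T$ consider the conditions: (i) $\lim_{t\to t_0}\|p(\xi_t)\|=\|p(\xi_{t_0})\|$ for all $p\in\mathbb C\langle z,z^*\rangle$; (ii) $\lim_{t\to t_0}\|p(\xi_t)\|=\|p(\xi_{t_0})\|$ for all $n\ge 1$ and all $p\in M_n(\mathbb C\langle z,z^*\rangle)$; (iii) $\lim_{t\to t_0}\|p(\xi_t)\|=\|p(\xi_{t_0})\|$ for all $n\ge 1$ and all $p\in M_n(\mathbb C_1\langle z,z^*\rangle)$; (iv) $\lim_{t\to t_0}d_H(\mathcal W_n(\xi_t),\mathcal W_n(\xi_{t_0}))=0$ for all $n\ge 1$. Then (i) $\Leftrightarrow$ (ii) $\Rightarrow$ (iii) $\Leftrightarrow$ (iv). -/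

import Mathlib

open Filter Topology
open scoped ComplexOrder CStarAlgebra ENNReal

/-- The algebra `ℂ⟨z, z*⟩` of `*`-polynomials in `d` noncommuting variables, as a free algebra on
`2 d` letters: the letter `Sum.inl i` is `z_i` and the letter `Sum.inr i` is `z_i*`. -/
abbrev StarPoly (d : ℕ) : Type := FreeAlgebra ℂ (Fin d ⊕ Fin d)

/-- The space `ℂ_k⟨z, z*⟩` of `*`-polynomials of degree at most `k`: the linear span of the words
of length at most `k` in the letters `z_i`, `z_i*`. -/
def starPolyDegreeLE (d k : ℕ) : Submodule ℂ (StarPoly d) :=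
  Submodule.span ℂ {p | ∃ w : List (Fin d ⊕ Fin d),
    w.length ≤ k ∧ p = (w.map (FreeAlgebra.ι ℂ)).prod}

section Evaluation

variable {d : ℕ} {A : Type*} [CStarAlgebra A]

/-- The evaluation `p ↦ p(ξ)`, sending `z_i` to `ξ_i` and `z_i*` to the adjoint of `ξ_i`. -/
noncomputable def evalStarPoly (ξ : Fin d → A) : StarPoly d →ₐ[ℂ] A :=
  FreeAlgebra.lift ℂ (Sum.elim ξ fun i => star (ξ i))

/-- The evaluation of a matrix-valued `*`-polynomial, entry by entry. The value lies in the
C⋆-algebra `M_n(A)`. -/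
noncomputable def evalMatrixStarPoly {n : ℕ} (ξ : Fin d → A)
    (p : Matrix (Fin n) (Fin n) (StarPoly d)) : CStarMatrix (Fin n) (Fin n) A :=
  CStarMatrix.ofMatrix (p.map (evalStarPoly ξ))

/-- The tuple `ξ` generates `A` as a unital C⋆-algebra. -/
def GeneratesCStar (ξ : Fin d → A) : Prop :=
  (StarAlgebra.adjoin ℂ (Set.range ξ)).topologicalClosure = ⊤

/-- The `n`-th level of the matrix range of `ξ`: all images of `ξ` under unital completely positive
maps from `A` to the C⋆-algebra `M_n(ℂ)`. -/
def matrixRange [PartialOrder A] [StarOrderedRing A] (n : ℕ) (ξ : Fin d → A) :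
    Set (Fin d → CStarMatrix (Fin n) (Fin n) ℂ) :=
  {X | ∃ φ : A →CP CStarMatrix (Fin n) (Fin n) ℂ, φ 1 = 1 ∧ ∀ i, φ (ξ i) = X i}

end Evaluation

/-- The row norm `‖X‖ = ‖∑ X_i X_i*‖^{1/2}` of a `d`-tuple of `n × n` matrices, where `M_n(ℂ)`
carries the operator norm. -/
noncomputable def rowNorm {d n : ℕ} (X : Fin d → CStarMatrix (Fin n) (Fin n) ℂ) : ℝ :=
  √‖∑ i, X i * star (X i)‖

/-- The Hausdorff distance `max (sup_{x ∈ E} d(x, F)) (sup_{y ∈ F} d(y, E))` of two sets of tuples,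
for the metric given by the row norm. It takes values in `[0, ∞]`. -/
noncomputable def rowHausdorffDist {d n : ℕ}
    (E F : Set (Fin d → CStarMatrix (Fin n) (Fin n) ℂ)) : ℝ≥0∞ :=
  max (⨆ x ∈ E, ⨅ y ∈ F, ENNReal.ofReal (rowNorm (x - y)))
    (⨆ y ∈ F, ⨅ x ∈ E, ENNReal.ofReal (rowNorm (y - x)))

section Conditions

variable {d : ℕ} {T : Type*} [MetricSpace T] {A : T → Type*} [∀ t, CStarAlgebra (A t)]
  [∀ t, PartialOrder (A t)] [∀ t, StarOrderedRing (A t)]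

/-- `‖p(ξ_t)‖ → ‖p(ξ_{t₀})‖` as `t → t₀`, for every scalar `*`-polynomial `p`. -/
def ScalarNormConvergence (ξ : (t : T) → Fin d → A t) (t₀ : T) : Prop :=
  ∀ p : StarPoly d,
    Tendsto (fun t => ‖evalStarPoly (ξ t) p‖) (𝓝 t₀) (𝓝 ‖evalStarPoly (ξ t₀) p‖)

/-- `‖p(ξ_t)‖ → ‖p(ξ_{t₀})‖` as `t → t₀`, for every matrix-valued `*`-polynomial `p`. -/
def MatrixNormConvergence (ξ : (t : T) → Fin d → A t) (t₀ : T) : Prop :=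
  ∀ n : ℕ, 1 ≤ n → ∀ p : Matrix (Fin n) (Fin n) (StarPoly d),
    Tendsto (fun t => ‖evalMatrixStarPoly (ξ t) p‖) (𝓝 t₀) (𝓝 ‖evalMatrixStarPoly (ξ t₀) p‖)

/-- `‖p(ξ_t)‖ → ‖p(ξ_{t₀})‖` as `t → t₀`, for every matrix-valued `*`-polynomial `p` of degree at
most one. -/
def PencilNormConvergence (ξ : (t : T) → Fin d → A t) (t₀ : T) : Prop :=
  ∀ n : ℕ, 1 ≤ n → ∀ p : Matrix (Fin n) (Fin n) (StarPoly d),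
    (∀ i j, p i j ∈ starPolyDegreeLE d 1) →
      Tendsto (fun t => ‖evalMatrixStarPoly (ξ t) p‖) (𝓝 t₀) (𝓝 ‖evalMatrixStarPoly (ξ t₀) p‖)

/-- The Hausdorff distance of the `n`-th levels of the matrix ranges of `ξ_t` and `ξ_{t₀}` tends to
zero as `t → t₀`, for every `n`. -/
def MatrixRangeConvergence (ξ : (t : T) → Fin d → A t) (t₀ : T) : Prop :=
  ∀ n : ℕ, 1 ≤ n →
    Tendsto (fun t => rowHausdorffDist (matrixRange n (ξ t)) (matrixRange n (ξ t₀))) (𝓝 t₀) (𝓝 0)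

end Conditions

/-!
Scalar and matrix-valued `*`-polynomials: if `b` is a self-adjoint element of `M_n(A)`, then
`‖b‖ = ‖b ^ 2 ^ k‖ ^ (1 / 2 ^ k)`, and the norm of `b ^ 2 ^ k` agrees with the sum of the norms of
its entries up to the factor `n ^ 2`. The `2 ^ k`-th root of that factor tends to `1`, so `‖b‖` is
squeezed between expressions in norms of elements of `A` whose ratio is arbitrarily close to `1`
(`CStarMatrix.norm_le_rpow_sum_norm_entry`). Applied to `p* p`, this gives the convergence for
matrix-valued `p`.

From pencil norms to matrix ranges: linear maps `φ : A → M_n(ℂ)` correspond to functionals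
`M ↦ ∑ φ(M_ij)_ij` on `M_n(A)`, and `φ` is completely positive as soon as the functional is positive
(`isChoiPositive_choiMap`). A point `X` of the matrix range of `ξ_s` therefore defines a functional
on the coefficients of pencils. Convergence of the norms `‖R - (L + L*)‖`, which is uniform on the
compact unit sphere of coefficients of the pencils `L`, makes this functional positive, up to a
small error, on the pencils with positive real part at `ξ_t`. The Riesz extension theorem with an
error term (`exists_nonneg_functional_near`) yields a nearby positive functional on `M_n(A_t)`, and
the corresponding completely positive map is corrected to a unital one
(`IsChoiPositive.exists_mem_matrixRange_near`). Its value at `ξ_t` is a point of the matrix range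
of `ξ_t` near `X`.

From matrix ranges to pencil norms: unital completely positive maps into `M_n(ℂ)` detect positivity
of self-adjoint elements of `M_n(A)` (`exists_unital_not_nonneg_map`). Hence the norm of a
self-adjoint pencil of size `n` is determined by the `n`-th level of the matrix range, with
Lipschitz dependence on the latter (`norm_le_add_of_forall_exists_close`). A general pencil of size
`m` is replaced by its hermitian dilation of size `2 m`, which has the same norm (`norm_dilation`).
-/

set_option linter.unusedSectionVars false

/-! ### Norms of C⋆-matrices and their entries -/

namespace CStarMatrix

section Norm

variable {n : Type*} [Fintype n] [DecidableEq n] {A : Type*} [CStarAlgebra A]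
  [PartialOrder A] [StarOrderedRing A]

/-- The matrix with a single nonzero entry `a` in position `(i, j)`. -/
def single (i j : n) (a : A) : CStarMatrix n n A := ofMatrix (Matrix.single i j a)

lemma single_apply (i j k l : n) (a : A) :
    single i j a k l = if i = k ∧ j = l then a else 0 := rfl

lemma single_add (i j : n) (a b : A) : single i j (a + b) = single i j a + single i j b :=
  Matrix.single_add i j a b

lemma smul_single (c : ℂ) (i j : n) (a : A) : single i j (c • a) = c • single i j a :=
  (Matrix.smul_single c i j a).symm

lemma star_single (i j : n) (a : A) : star (single i j a) = single j i (star a) :=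
  Matrix.conjTranspose_single i j a

lemma single_mul_single (i j k : n) (a b : A) :
    single i j a * single j k b = single i k (a * b) :=
  Matrix.single_mul_single_same ..

lemma sum_single (M : CStarMatrix n n A) : ∑ i, ∑ j, single i j (M i j) = M :=
  (Matrix.matrix_eq_sum_single (M : Matrix n n A)).symm

lemma sum_apply {ι : Type*} (s : Finset ι) (f : ι → CStarMatrix n n A) (i j : n) :
    (∑ k ∈ s, f k) i j = ∑ k ∈ s, f k i j :=
  Matrix.sum_apply i j s f

/-- The corner embedding `a ↦ single i i a`. -/
def singleStarHom (i : n) : A →⋆ₙₐ[ℂ] CStarMatrix n n A where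
  toFun := single i i
  map_smul' c a := smul_single c i i a
  map_zero' := Matrix.single_zero i i
  map_add' := single_add i i
  map_mul' a b := (single_mul_single i i i a b).symm
  map_star' a := (star_single i i a).symm

lemma norm_single_le (i j : n) (a : A) : ‖single i j a‖ ≤ ‖a‖ := by
  have h : ‖single i j a‖ * ‖single i j a‖ ≤ ‖a‖ * ‖a‖ := by
    rw [← CStarRing.norm_star_mul_self, ← CStarRing.norm_star_mul_self, star_single,
      single_mul_single]
    exact NonUnitalStarAlgHom.norm_apply_le (singleStarHom j) (star a * a)
  exact abs_le_of_sq_le_sq' (by nlinarith) (norm_nonneg a) |>.2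

lemma norm_le_sum_norm_entry (M : CStarMatrix n n A) : ‖M‖ ≤ ∑ i, ∑ j, ‖M i j‖ := by
  conv_lhs => rw [← sum_single M]
  exact (norm_sum_le _ _).trans (Finset.sum_le_sum fun i _ => (norm_sum_le _ _).trans
    (Finset.sum_le_sum fun j _ => norm_single_le i j _))

lemma sum_norm_entry_le (M : CStarMatrix n n A) :
    ∑ i, ∑ j, ‖M i j‖ ≤ (Fintype.card n : ℝ) ^ 2 * ‖M‖ := by
  calc ∑ i, ∑ j, ‖M i j‖ ≤ ∑ _i : n, ∑ _j : n, ‖M‖ :=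
        Finset.sum_le_sum fun i _ => Finset.sum_le_sum fun j _ => norm_entry_le_norm
    _ = (Fintype.card n : ℝ) ^ 2 * ‖M‖ := by simp [sq, mul_assoc]

end Norm

end CStarMatrix

/-! ### Evaluation of `*`-polynomials -/

section Evaluation

variable {d : ℕ} {A : Type*} [CStarAlgebra A]

@[simp] lemma evalMatrixStarPoly_apply {n : ℕ} (ξ : Fin d → A)
    (p : Matrix (Fin n) (Fin n) (StarPoly d)) (i j : Fin n) :
    evalMatrixStarPoly ξ p i j = evalStarPoly ξ (p i j) := rfl

lemma evalMatrixStarPoly_mul {n : ℕ} (ξ : Fin d → A)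
    (p q : Matrix (Fin n) (Fin n) (StarPoly d)) :
    evalMatrixStarPoly ξ (p * q) = evalMatrixStarPoly ξ p * evalMatrixStarPoly ξ q := by
  ext i j
  simp [Matrix.mul_apply, CStarMatrix.mul_apply]

lemma evalMatrixStarPoly_one {n : ℕ} (ξ : Fin d → A) :
    evalMatrixStarPoly ξ (1 : Matrix (Fin n) (Fin n) (StarPoly d)) = 1 := by
  ext i j
  by_cases h : i = j <;> simp [CStarMatrix.one_apply, h]

lemma evalMatrixStarPoly_pow {n : ℕ} (ξ : Fin d → A)
    (p : Matrix (Fin n) (Fin n) (StarPoly d)) (k : ℕ) :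
    evalMatrixStarPoly ξ (p ^ k) = evalMatrixStarPoly ξ p ^ k := by
  induction k with
  | zero => simp [evalMatrixStarPoly_one]
  | succ k ih => rw [pow_succ, pow_succ, evalMatrixStarPoly_mul, ih]

end Evaluation

universe u

/-- Every `*`-polynomial has a formal adjoint. -/
lemma exists_evalStarPoly_eq_star {d : ℕ} (p : StarPoly d) :
    ∃ q : StarPoly d, ∀ (A : Type u) [CStarAlgebra A] (ξ : Fin d → A),
      evalStarPoly ξ q = star (evalStarPoly ξ p) := by
  induction p using FreeAlgebra.induction with
  | grade0 r =>
    refine ⟨algebraMap ℂ _ (star r), fun A _ ξ => ?_⟩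
    rw [AlgHom.commutes, AlgHom.commutes, algebraMap_star_comm]
  | grade1 x =>
    refine ⟨FreeAlgebra.ι ℂ x.swap, fun A _ ξ => ?_⟩
    cases x <;> simp [evalStarPoly]
  | mul a b ha hb =>
    obtain ⟨a', ha⟩ := ha
    obtain ⟨b', hb⟩ := hb
    exact ⟨b' * a', fun A _ ξ => by simp [ha, hb]⟩
  | add a b ha hb =>
    obtain ⟨a', ha⟩ := ha
    obtain ⟨b', hb⟩ := hb
    exact ⟨a' + b', fun A _ ξ => by simp [ha, hb]⟩

lemma exists_evalMatrixStarPoly_eq_star {d n : ℕ} (p : Matrix (Fin n) (Fin n) (StarPoly d)) :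
    ∃ q : Matrix (Fin n) (Fin n) (StarPoly d), ∀ (A : Type u) [CStarAlgebra A] (ξ : Fin d → A),
      evalMatrixStarPoly ξ q = star (evalMatrixStarPoly ξ p) := by
  choose f hf using fun p : StarPoly d => exists_evalStarPoly_eq_star.{u} p
  refine ⟨fun i j => f (p j i), fun A _ ξ => ?_⟩
  ext i j
  rw [CStarMatrix.star_apply]
  exact hf _ A ξ

/-! ### From scalar to matrix-valued `*`-polynomials -/

/-- A function squeezed, up to factors arbitrarily close to `1`, by functions that converge to
their value at a point converges to its own value there. -/
lemma tendsto_of_forall_exists_squeeze {T : Type*} {l : Filter T} {g : T → ℝ} {t₀ : T}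
    (h : ∀ c : ℝ, 1 < c → ∃ f : T → ℝ, (∀ t, g t ≤ f t) ∧ (∀ t, f t ≤ c * g t) ∧
      Tendsto f l (𝓝 (f t₀))) :
    Tendsto g l (𝓝 (g t₀)) := by
  -- A factor `c > 1` close to `1` keeps `c * x` below any `b > x`.
  have key : ∀ x b : ℝ, x < b → ∃ c : ℝ, 1 < c ∧ c * x < b := by
    intro x b hxb
    have : Tendsto (fun c : ℝ => c * x) (𝓝[>] 1) (𝓝 (1 * x)) :=
      ((continuous_id.mul continuous_const).tendsto 1).mono_left nhdsWithin_le_nhds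
    rw [one_mul] at this
    obtain ⟨c, hc, hc'⟩ := ((this.eventually (gt_mem_nhds hxb)).and self_mem_nhdsWithin).exists
    exact ⟨c, hc', hc⟩
  refine tendsto_order.2 ⟨fun a ha => ?_, fun b hb => ?_⟩
  · obtain ⟨c, hc, hca⟩ : ∃ c : ℝ, 1 < c ∧ c * a < g t₀ := key a (g t₀) ha
    obtain ⟨f, h1, h2, h3⟩ := h c hc
    filter_upwards [h3.eventually (lt_mem_nhds (hca.trans_le (h1 t₀)))] with t ht
    exact lt_of_mul_lt_mul_left (ht.trans_le (h2 t)) (by linarith)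
  · obtain ⟨c, hc, hcb⟩ := key (g t₀) b hb
    obtain ⟨f, h1, h2, h3⟩ := h c hc
    filter_upwards [h3.eventually (gt_mem_nhds ((h2 t₀).trans_lt hcb))] with t ht
    exact (h1 t).trans_lt ht

/-- For a self-adjoint `b` in `M_n(A)` the numbers `(∑ ‖(b ^ 2 ^ k)_ij‖) ^ (1 / 2 ^ k)` lie between
`‖b‖` and `n ^ (2 / 2 ^ k) ‖b‖`, so the norm of `b` is governed by norms of elements of `A`. -/
lemma CStarMatrix.norm_le_rpow_sum_norm_entry {n : ℕ} {A : Type*} [CStarAlgebra A]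
    [PartialOrder A] [StarOrderedRing A]
    {b : CStarMatrix (Fin n) (Fin n) A} (hb : IsSelfAdjoint b) (k : ℕ) :
    ‖b‖ ≤ (∑ i, ∑ j, ‖(b ^ 2 ^ k) i j‖) ^ (((2 ^ k : ℕ) : ℝ)⁻¹) ∧
      (∑ i, ∑ j, ‖(b ^ 2 ^ k) i j‖) ^ (((2 ^ k : ℕ) : ℝ)⁻¹) ≤
        ((n : ℝ) ^ 2) ^ (((2 ^ k : ℕ) : ℝ)⁻¹) * ‖b‖ := by
  have hk : (2 ^ k : ℕ) ≠ 0 := by positivity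
  have hpow : ‖b ^ 2 ^ k‖ = ‖b‖ ^ 2 ^ k := by
    simpa using congrArg NNReal.toReal (hb.nnnorm_pow_two_pow k)
  have h1 := norm_le_sum_norm_entry (b ^ 2 ^ k)
  have h2 := sum_norm_entry_le (b ^ 2 ^ k)
  rw [hpow] at h1 h2
  rw [Fintype.card_fin] at h2
  have hroot : ‖b‖ = (‖b‖ ^ 2 ^ k) ^ (((2 ^ k : ℕ) : ℝ)⁻¹) :=
    (Real.pow_rpow_inv_natCast (norm_nonneg b) hk).symm
  constructor
  · conv_lhs => rw [hroot]
    exact Real.rpow_le_rpow (by positivity) h1 (by positivity)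
  · conv_rhs => rw [hroot, ← Real.mul_rpow (by positivity) (by positivity)]
    exact Real.rpow_le_rpow (by positivity) h2 (by positivity)

lemma norm_evalMatrixStarPoly_const {d : ℕ} {A : Type*} [CStarAlgebra A] [PartialOrder A]
    [StarOrderedRing A] (ξ : Fin d → A) (p : StarPoly d) :
    ‖evalMatrixStarPoly (n := 1) ξ (fun _ _ => p)‖ = ‖evalStarPoly ξ p‖ :=
  le_antisymm ((CStarMatrix.norm_le_sum_norm_entry _).trans (le_of_eq (by simp; rfl)))
    (CStarMatrix.norm_entry_le_norm (M := evalMatrixStarPoly (n := 1) ξ (fun _ _ => p))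
      (i := 0) (j := 0))

section Scalar

variable {d : ℕ} {T : Type*} [MetricSpace T] {A : T → Type u} [∀ t, CStarAlgebra (A t)]
  [∀ t, PartialOrder (A t)] [∀ t, StarOrderedRing (A t)]
  {ξ : (t : T) → Fin d → A t} {t₀ : T}

lemma ScalarNormConvergence.matrixNormConvergence (h : ScalarNormConvergence ξ t₀) :
    MatrixNormConvergence ξ t₀ := by
  intro n hn p
  obtain ⟨q, hq⟩ := exists_evalMatrixStarPoly_eq_star.{u} p
  have hev : ∀ t, evalMatrixStarPoly (ξ t) (q * p) =
      star (evalMatrixStarPoly (ξ t) p) * evalMatrixStarPoly (ξ t) p := fun t => by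
    rw [evalMatrixStarPoly_mul, hq]
  have hsa : ∀ t, IsSelfAdjoint (evalMatrixStarPoly (ξ t) (q * p)) := fun t => by
    rw [hev]; exact IsSelfAdjoint.star_mul_self _
  have main : Tendsto (fun t => ‖evalMatrixStarPoly (ξ t) (q * p)‖) (𝓝 t₀)
      (𝓝 ‖evalMatrixStarPoly (ξ t₀) (q * p)‖) := by
    refine tendsto_of_forall_exists_squeeze
      (g := fun t => ‖evalMatrixStarPoly (ξ t) (q * p)‖) fun c hc => ?_
    obtain ⟨k, hk⟩ : ∃ k : ℕ, ((n : ℝ) ^ 2) ^ (((2 ^ k : ℕ) : ℝ)⁻¹) < c := by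
      have h1 : Tendsto (fun k : ℕ => (((2 ^ k : ℕ) : ℝ)⁻¹)) atTop (𝓝 0) :=
        tendsto_inv_atTop_zero.comp (tendsto_natCast_atTop_atTop.comp
          (tendsto_pow_atTop_atTop_of_one_lt (by norm_num)))
      have h2 : Tendsto (fun k : ℕ => ((n : ℝ) ^ 2) ^ (((2 ^ k : ℕ) : ℝ)⁻¹)) atTop
          (𝓝 (((n : ℝ) ^ 2) ^ (0 : ℝ))) :=
        (Real.continuousAt_const_rpow (by positivity)).tendsto.comp h1
      rw [Real.rpow_zero] at h2
      exact (h2.eventually (gt_mem_nhds hc)).exists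
    refine ⟨fun t => (∑ i, ∑ j, ‖(evalMatrixStarPoly (ξ t) (q * p) ^ 2 ^ k) i j‖) ^
        (((2 ^ k : ℕ) : ℝ)⁻¹),
      fun t => (CStarMatrix.norm_le_rpow_sum_norm_entry (hsa t) k).1,
      fun t => (CStarMatrix.norm_le_rpow_sum_norm_entry (hsa t) k).2.trans
        (mul_le_mul_of_nonneg_right hk.le (norm_nonneg _)), ?_⟩
    refine Tendsto.rpow_const ?_ (Or.inr (by positivity))
    refine tendsto_finsetSum _ fun i _ => tendsto_finsetSum _ fun j _ => ?_
    simp only [← evalMatrixStarPoly_pow, evalMatrixStarPoly_apply]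
    exact h _
  have hnorm : ∀ t, ‖evalMatrixStarPoly (ξ t) p‖ = √‖evalMatrixStarPoly (ξ t) (q * p)‖ :=
    fun t => by rw [hev, CStarRing.norm_star_mul_self, Real.sqrt_mul_self (norm_nonneg _)]
  simp only [hnorm]
  exact main.sqrt

lemma MatrixNormConvergence.scalarNormConvergence (h : MatrixNormConvergence ξ t₀) :
    ScalarNormConvergence ξ t₀ := fun p => by
  simpa only [norm_evalMatrixStarPoly_const] using h 1 le_rfl (fun _ _ => p)

lemma MatrixNormConvergence.pencilNormConvergence (h : MatrixNormConvergence ξ t₀) :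
    PencilNormConvergence ξ t₀ :=
  fun n hn p _ => h n hn p

end Scalar

/-! ### Positive functionals -/

/-- A form of the M. Riesz extension theorem in which the functional is given on a parameter space
`P` instead of a subspace of `E`; the parametrization `L` need not be injective. -/
lemma exists_nonneg_extension {P E : Type*} [AddCommGroup P] [Module ℝ P] [AddCommGroup E]
    [Module ℝ E] (K : PointedCone ℝ E) (L : P →ₗ[ℝ] E) (ℓ : P →ₗ[ℝ] ℝ)
    (hpos : ∀ p, L p ∈ K → 0 ≤ ℓ p) (hcof : ∀ y, ∃ p, L p + y ∈ K) :
    ∃ g : E →ₗ[ℝ] ℝ, (∀ p, g (L p) = ℓ p) ∧ ∀ x ∈ K, 0 ≤ g x := by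
  have hker : ∀ p, L p = 0 → ℓ p = 0 := fun p hp =>
    le_antisymm (by simpa using hpos (-p) (by simp [hp])) (hpos p (by simp [hp]))
  obtain ⟨s, hs⟩ := L.rangeRestrict.exists_rightInverse_of_surjective L.range_rangeRestrict
  have hs' : ∀ y, L (s y) = y := fun y => congrArg Subtype.val (LinearMap.congr_fun hs y)
  obtain ⟨g, hg, hgK⟩ := riesz_extension K ⟨LinearMap.range L, ℓ ∘ₗ s⟩
    (fun x hx => hpos _ (by rw [hs']; exact hx))
    (fun y => let ⟨p, hp⟩ := hcof y; ⟨⟨L p, p, rfl⟩, hp⟩)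
  refine ⟨g, fun p => ?_, hgK⟩
  have h1 : g (L p) = ℓ (s ⟨L p, p, rfl⟩) := hg ⟨L p, p, rfl⟩
  have h2 := hker (s ⟨L p, p, rfl⟩ - p) (by rw [map_sub, hs', sub_self])
  rw [map_sub, sub_eq_zero] at h2
  rw [h1, h2]

section Functional

variable {B : Type*} [CStarAlgebra B] [PartialOrder B] [StarOrderedRing B]

lemma exists_eq_star_mul_self_of_nonneg {a : B} (ha : 0 ≤ a) : ∃ b, a = star b * b :=
  CStarAlgebra.nonneg_iff_eq_star_mul_self.1 ha

lemma algebraMap_real_eq_complex_smul (r : ℝ) : algebraMap ℝ B r = (r : ℂ) • 1 := by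
  rw [Algebra.algebraMap_eq_smul_one, Complex.coe_smul]

lemma IsSelfAdjoint.le_smul_one {a : B} (ha : IsSelfAdjoint a) {r : ℝ} (hr : ‖a‖ ≤ r) :
    a ≤ (r : ℂ) • 1 := by
  rw [← algebraMap_real_eq_complex_smul]
  exact ha.le_algebraMap_norm_self.trans (algebraMap_mono B hr)

lemma IsSelfAdjoint.neg_smul_one_le {a : B} (ha : IsSelfAdjoint a) {r : ℝ} (hr : ‖a‖ ≤ r) :
    -((r : ℂ) • 1) ≤ a := by
  rw [neg_le]
  exact ha.neg.le_smul_one (by rwa [norm_neg])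

lemma norm_le_of_le_smul_one {a : B} (ha : 0 ≤ a) {r : ℝ} (hr : 0 ≤ r)
    (h : a ≤ (r : ℂ) • 1) : ‖a‖ ≤ r := by
  rw [← algebraMap_real_eq_complex_smul] at h
  exact (CStarAlgebra.norm_le_iff_le_algebraMap a hr ha).2 h

lemma algebraMap_norm_add_star_nonneg (y : B) :
    0 ≤ algebraMap ℝ B ‖y + star y‖ + (y + star y) := by
  have h : IsSelfAdjoint (y + star y) := IsSelfAdjoint.add_star_self y
  have := h.neg_algebraMap_norm_le_self
  rwa [neg_le_iff_add_nonneg'] at this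

variable (B) in
/-- The real cone of elements with positive real part. It contains every skew-adjoint element
together with its negative, so a real functional that is nonnegative on it vanishes on skew-adjoint
elements. -/
def rePosCone : PointedCone ℝ B where
  carrier := {x | 0 ≤ x + star x}
  zero_mem' := by simp
  add_mem' {x y} hx hy := by
    change 0 ≤ x + y + star (x + y)
    rw [star_add, add_add_add_comm]
    exact add_nonneg hx hy
  smul_mem' c x hx := by
    change 0 ≤ (c : ℝ) • x + star ((c : ℝ) • x)
    rw [star_smul, star_trivial, ← smul_add]
    exact smul_nonneg c.2 hx

lemma mem_rePosCone {x : B} : x ∈ rePosCone B ↔ 0 ≤ x + star x := Iff.rfl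

lemma exists_algebraMap_add_mem_rePosCone (y : B) :
    ∃ r : ℝ, algebraMap ℝ B r + y ∈ rePosCone B := by
  refine ⟨‖y + star y‖, ?_⟩
  rw [mem_rePosCone, star_add, ← algebraMap_star_comm, star_trivial ‖y + star y‖]
  have h0 : 0 ≤ algebraMap ℝ B ‖y + star y‖ := algebraMap_nonneg B (norm_nonneg _)
  have := add_nonneg h0 (algebraMap_norm_add_star_nonneg y)
  convert this using 1
  abel

/-- The complexification of a real functional that is nonnegative on `rePosCone` is positive. -/
lemma extendRCLike_nonneg {g : B →ₗ[ℝ] ℝ} (hg : ∀ x ∈ rePosCone B, 0 ≤ g x) {x : B}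
    (hx : 0 ≤ x) : 0 ≤ (Module.Dual.extendRCLike (𝕜 := ℂ) g) x := by
  have hsa : star x = x := (IsSelfAdjoint.of_nonneg hx).star_eq
  have h1 : 0 ≤ g x := hg x (by rw [mem_rePosCone, hsa]; exact add_nonneg hx hx)
  have h2 : 0 ≤ g (Complex.I • x) := hg _ (by simp [mem_rePosCone, hsa])
  have h3 : 0 ≤ g (-(Complex.I • x)) := hg _ (by simp [mem_rePosCone, hsa])
  rw [map_neg] at h3
  have h4 : g (Complex.I • x) = 0 := by linarith
  rw [Module.Dual.extendRCLike_apply]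
  simp [h4, h1]

/-- A self-adjoint element that is not positive is detected by a positive functional. -/
lemma exists_nonneg_functional_neg {h : B} (hsa : IsSelfAdjoint h) (hneg : ¬ 0 ≤ h) :
    ∃ ρ : B →ₗ[ℂ] ℂ, (∀ x, 0 ≤ x → 0 ≤ ρ x) ∧ (ρ h).re < 0 := by
  obtain ⟨l, hl, hl0⟩ : ∃ l ∈ spectrum ℝ h, l < 0 := by
    by_contra! hcon
    exact hneg ((StarOrderedRing.nonneg_iff_spectrum_nonneg (R := ℝ) h hsa).2 hcon)
  let L : ℝ × ℝ →ₗ[ℝ] B :=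
    (LinearMap.toSpanSingleton ℝ B 1).coprod (LinearMap.toSpanSingleton ℝ B h)
  let ℓ : ℝ × ℝ →ₗ[ℝ] ℝ :=
    (LinearMap.toSpanSingleton ℝ ℝ 1).coprod (LinearMap.toSpanSingleton ℝ ℝ l)
  have hL : ∀ p, L p = algebraMap ℝ B p.1 + p.2 • h := fun p => by
    simp [L, Algebra.algebraMap_eq_smul_one]
  obtain ⟨g, hg, hgK⟩ := exists_nonneg_extension (rePosCone B) L ℓ
    (fun p hp => by
      have hsa' : IsSelfAdjoint (algebraMap ℝ B p.1 + p.2 • h) :=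
        (IsSelfAdjoint.algebraMap B (IsSelfAdjoint.all p.1)).add ((IsSelfAdjoint.all p.2).smul hsa)
      rw [hL, mem_rePosCone, hsa'.star_eq, ← two_smul ℝ,
        smul_nonneg_iff_nonneg_of_pos_left two_pos] at hp
      -- spectral mapping: `p.1 + p.2 * l` is a spectral value of the positive element
      have hmem : p.1 + p.2 * l ∈ spectrum ℝ (algebraMap ℝ B p.1 + p.2 • h) := by
        have := spectrum.subset_polynomial_aeval h
          (Polynomial.C p.1 + Polynomial.C p.2 * Polynomial.X) ⟨l, hl, rfl⟩
        simpa [Algebra.smul_def] using this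
      have := spectrum_nonneg_of_nonneg hp hmem
      simpa [ℓ] using this)
    (fun y => let ⟨r, hr⟩ := exists_algebraMap_add_mem_rePosCone y
      ⟨(r, 0), by rw [hL]; simpa using hr⟩)
  refine ⟨Module.Dual.extendRCLike g, fun x hx => extendRCLike_nonneg hgK hx, ?_⟩
  have h1 := Module.Dual.re_extendRCLike_apply (𝕜 := ℂ) g h
  have h2 : g h = l := by
    have := hg (0, 1)
    simpa [hL, ℓ] using this
  exact h1.trans_lt (h2 ▸ hl0)

end Functional

/-! ### Positivity of block matrices -/

/-- A complex matrix with nonnegative quadratic form is positive semidefinite; over `ℂ` it is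
automatically Hermitian. -/
lemma Matrix.posSemidef_of_dotProduct_mulVec_nonneg {ι : Type*} [Fintype ι] [DecidableEq ι]
    {G : Matrix ι ι ℂ} (h : ∀ x : ι → ℂ, 0 ≤ star x ⬝ᵥ G.mulVec x) : G.PosSemidef := by
  rw [← Matrix.isPositive_toEuclideanLin_iff, LinearMap.isPositive_iff_complex]
  intro x
  have h1 : inner ℂ (G.toEuclideanLin x) x = star (star x.ofLp ⬝ᵥ G.mulVec x.ofLp) := by
    rw [EuclideanSpace.inner_eq_star_dotProduct, Matrix.star_dotProduct, star_star,
      Matrix.ofLp_toLpLin, Matrix.toLin'_apply, dotProduct_comm]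
  have h2 := Complex.nonneg_iff.1 (h x.ofLp)
  rw [h1]
  refine ⟨?_, ?_⟩
  · apply Complex.ext <;> simp [← h2.2]
  · simpa using h2.1

namespace CStarMatrix

section Blocks

variable {k n : ℕ}

/-- A block matrix as a matrix indexed by pairs. -/
def flatten (G : CStarMatrix (Fin k) (Fin k) (CStarMatrix (Fin n) (Fin n) ℂ)) :
    Matrix (Fin k × Fin n) (Fin k × Fin n) ℂ :=
  Matrix.of fun x y => G x.1 y.1 x.2 y.2

lemma flatten_star_mul_self (D : CStarMatrix (Fin k) (Fin k) (CStarMatrix (Fin n) (Fin n) ℂ)) :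
    flatten (star D * D) = (flatten D).conjTranspose * flatten D := by
  ext x y
  simp [flatten, Matrix.mul_apply, mul_apply, star_apply, sum_apply, Fintype.sum_prod_type]

lemma flatten_injective : Function.Injective (flatten (k := k) (n := n)) := fun G H h => by
  ext i j r s
  exact congrFun (congrFun h (i, r)) (j, s)

lemma flatten_surjective : Function.Surjective (flatten (k := k) (n := n)) := fun D =>
  ⟨ofMatrix fun i j => ofMatrix fun r s => D (i, r) (j, s), rfl⟩

lemma nonneg_iff_posSemidef_flatten
    {G : CStarMatrix (Fin k) (Fin k) (CStarMatrix (Fin n) (Fin n) ℂ)} :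
    0 ≤ G ↔ (flatten G).PosSemidef := by
  constructor
  · intro hG
    obtain ⟨D, rfl⟩ := exists_eq_star_mul_self_of_nonneg hG
    rw [flatten_star_mul_self]
    exact Matrix.posSemidef_conjTranspose_mul_self _
  · intro hG
    open scoped MatrixOrder in
    obtain ⟨D, hD⟩ := CStarAlgebra.nonneg_iff_eq_star_mul_self.1 hG.nonneg
    obtain ⟨D, rfl⟩ := flatten_surjective D
    rw [Matrix.star_eq_conjTranspose, ← flatten_star_mul_self] at hD
    rw [flatten_injective hD]
    exact star_mul_self_nonneg D

lemma star_dotProduct_flatten_mulVec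
    (G : CStarMatrix (Fin k) (Fin k) (CStarMatrix (Fin n) (Fin n) ℂ)) (x : Fin k × Fin n → ℂ) :
    star x ⬝ᵥ (flatten G).mulVec x =
      ∑ i, ∑ r, star (x (i, r)) * ∑ j, ∑ s, G i j r s * x (j, s) := by
  simp only [dotProduct, Matrix.mulVec, Fintype.sum_prod_type]
  rfl

/-- Positivity of a block matrix is the nonnegativity of its quadratic form. -/
lemma nonneg_iff_quadraticForm
    {G : CStarMatrix (Fin k) (Fin k) (CStarMatrix (Fin n) (Fin n) ℂ)} :
    0 ≤ G ↔ ∀ v : Fin k → Fin n → ℂ,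
      0 ≤ ∑ i, ∑ r, star (v i r) * ∑ j, ∑ s, G i j r s * v j s := by
  rw [nonneg_iff_posSemidef_flatten]
  constructor
  · intro h v
    simpa only [star_dotProduct_flatten_mulVec] using
      h.dotProduct_mulVec_nonneg fun x => v x.1 x.2
  · intro h
    refine Matrix.posSemidef_of_dotProduct_mulVec_nonneg fun x => ?_
    rw [star_dotProduct_flatten_mulVec]
    exact h fun i r => x (i, r)

end Blocks

end CStarMatrix

/-! ### Completely positive maps into matrix algebras -/

section CompletelyPositive

variable {A : Type*} [CStarAlgebra A] [PartialOrder A] [StarOrderedRing A] {n : ℕ}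

/-- Choi's criterion for complete positivity of a linear map `φ : A → M_n(ℂ)`: the functional
`a ↦ ∑ φ(a_rs)_rs` on `M_n(A)` is nonnegative on the elements `(b_r* b_s)`. -/
def IsChoiPositive (φ : A →ₗ[ℂ] CStarMatrix (Fin n) (Fin n) ℂ) : Prop :=
  ∀ b : Fin n → A, 0 ≤ ∑ r, ∑ s, φ (star (b r) * b s) r s

/-- Choi positivity implies positivity at every matrix level: for `M = D* D`, the quadratic form of
`φ(M)` at `v` is the sum over the rows `l` of `D` of the Choi sums of the tuples
`(∑ i, v_ir D_li)_r`. -/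
lemma IsChoiPositive.map_cstarMatrix_nonneg {φ : A →ₗ[ℂ] CStarMatrix (Fin n) (Fin n) ℂ}
    (hφ : IsChoiPositive φ) (k : ℕ) (M : CStarMatrix (Fin k) (Fin k) A) (hM : 0 ≤ M) :
    0 ≤ M.map φ := by
  obtain ⟨D, rfl⟩ := exists_eq_star_mul_self_of_nonneg hM
  rw [CStarMatrix.nonneg_iff_quadraticForm]
  intro v
  have h : ∑ i, ∑ r, star (v i r) * ∑ j, ∑ s, ((star D * D).map φ) i j r s * v j s =
      ∑ l, ∑ r, ∑ s, φ (star (∑ i, v i r • D l i) * ∑ j, v j s • D l j) r s := by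
    have h1 : ∀ l r s, φ (star (∑ i, v i r • D l i) * ∑ j, v j s • D l j) r s =
        ∑ i, ∑ j, star (v i r) * (φ (star (D l i) * D l j) r s * v j s) := fun l r s => by
      simp only [star_sum, Finset.sum_mul, Finset.mul_sum, map_sum, CStarMatrix.sum_apply,
        star_smul, smul_mul_smul_comm, map_smul, CStarMatrix.smul_apply, smul_eq_mul]
      rw [Finset.sum_comm]
      refine Finset.sum_congr rfl fun i _ => Finset.sum_congr rfl fun j _ => ?_
      ring
    have h2 : ∀ i j r s, ((star D * D).map φ) i j r s =
        ∑ l, φ (star (D l i) * D l j) r s := fun i j r s => by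
      simp [CStarMatrix.mul_apply, CStarMatrix.star_apply, CStarMatrix.sum_apply]
    have hswap : ∀ f : Fin n → Fin k → ℂ, ∑ r, ∑ i, f r i = ∑ i, ∑ r, f r i :=
      fun f => Finset.sum_comm
    simp only [h1]
    simp only [h2, Finset.sum_mul, Finset.mul_sum, hswap]
    exact (Finset.sum_congr rfl fun i _ => Finset.sum_comm).trans Finset.sum_comm
  rw [h]
  exact Finset.sum_nonneg fun l _ => hφ _

/-- A Choi-positive map as a completely positive map. -/
noncomputable def IsChoiPositive.toCompletelyPositiveMap {φ : A →ₗ[ℂ] CStarMatrix (Fin n) (Fin n) ℂ}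
    (hφ : IsChoiPositive φ) : A →CP CStarMatrix (Fin n) (Fin n) ℂ :=
  { φ with map_cstarMatrix_nonneg' := hφ.map_cstarMatrix_nonneg }

/-- The map `A → M_n(ℂ)` attached to a functional `ρ` on `M_n(A)`: its `(r, s)` entry at `a` is the
value of `ρ` at the matrix whose only nonzero entry is `a` in position `(r, s)`. -/
noncomputable def choiMap (ρ : CStarMatrix (Fin n) (Fin n) A →ₗ[ℂ] ℂ) :
    A →ₗ[ℂ] CStarMatrix (Fin n) (Fin n) ℂ where
  toFun a := CStarMatrix.ofMatrix fun r s => ρ (CStarMatrix.single r s a)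
  map_add' a b := by
    ext r s
    exact (congrArg ρ (CStarMatrix.single_add r s a b)).trans (map_add ρ _ _)
  map_smul' c a := by
    ext r s
    exact (congrArg ρ (CStarMatrix.smul_single c r s a)).trans (map_smul ρ _ _)

lemma choiMap_apply (ρ : CStarMatrix (Fin n) (Fin n) A →ₗ[ℂ] ℂ) (a : A) (r s : Fin n) :
    choiMap ρ a r s = ρ (CStarMatrix.single r s a) := rfl

lemma sum_choiMap_apply (ρ : CStarMatrix (Fin n) (Fin n) A →ₗ[ℂ] ℂ)
    (M : CStarMatrix (Fin n) (Fin n) A) : ∑ r, ∑ s, choiMap ρ (M r s) r s = ρ M := by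
  simp only [choiMap_apply, ← map_sum, CStarMatrix.sum_single]

lemma isChoiPositive_choiMap {ρ : CStarMatrix (Fin n) (Fin n) A →ₗ[ℂ] ℂ}
    (hρ : ∀ x, 0 ≤ x → 0 ≤ ρ x) : IsChoiPositive (choiMap ρ) := by
  intro b
  rcases Nat.eq_zero_or_pos n with rfl | hn
  · simp
  -- the matrix `(b_r* b_s)` is `D* D` for the matrix `D` whose only nonzero row is `b`
  let D : CStarMatrix (Fin n) (Fin n) A :=
    CStarMatrix.ofMatrix fun r s => if r = ⟨0, hn⟩ then b s else 0
  have hD : ∀ r s, star (b r) * b s = (star D * D) r s := fun r s => by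
    have hD' : ∀ r s, D r s = if r = ⟨0, hn⟩ then b s else 0 := fun _ _ => rfl
    simp [hD', CStarMatrix.mul_apply, CStarMatrix.star_apply]
  simp only [hD]
  rw [sum_choiMap_apply]
  exact hρ _ (star_mul_self_nonneg D)

end CompletelyPositive

section ChoiPositive

variable {A : Type*} [CStarAlgebra A] [PartialOrder A] [StarOrderedRing A] {n : ℕ}
  {φ ψ : A →ₗ[ℂ] CStarMatrix (Fin n) (Fin n) ℂ}

lemma IsChoiPositive.add (hφ : IsChoiPositive φ) (hψ : IsChoiPositive ψ) :
    IsChoiPositive (φ + ψ) := fun b => by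
  simpa [Finset.sum_add_distrib] using add_nonneg (hφ b) (hψ b)

lemma IsChoiPositive.smul (hφ : IsChoiPositive φ) {c : ℂ} (hc : 0 ≤ c) :
    IsChoiPositive (c • φ) := fun b => by
  simpa [Finset.mul_sum] using mul_nonneg hc (hφ b)

lemma IsChoiPositive.apply_diag_nonneg (hφ : IsChoiPositive φ) (r : Fin n) (a : A) :
    0 ≤ φ (star a * a) r r := by
  have h := hφ (Pi.single r a)
  have h0 : ∀ x y, φ (star ((Pi.single r a : Fin n → A) x) * (Pi.single r a : Fin n → A) y) x y =
      if x = r then if y = r then φ (star a * a) r r else 0 else 0 := fun x y => by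
    by_cases hx : x = r
    · subst hx
      by_cases hy : y = x
      · subst hy; simp
      · simp [hy]
    · simp [hx]
  simpa [h0] using h

/-- The `(r, r)` entry of a map into matrices, as a functional. -/
noncomputable def diagEntry (φ : A →ₗ[ℂ] CStarMatrix (Fin n) (Fin n) ℂ) (r : Fin n) :
    A →ₗ[ℂ] ℂ where
  toFun a := φ a r r
  map_add' a b := by simp
  map_smul' c a := by simp

lemma sum_sum_comm_pairs {α β : Type*} [Fintype α] [Fintype β] (f : α → α → β → β → ℂ) :
    ∑ a, ∑ b, ∑ c, ∑ e, f a b c e = ∑ c, ∑ e, ∑ a, ∑ b, f a b c e :=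
  calc ∑ a, ∑ b, ∑ c, ∑ e, f a b c e = ∑ a, ∑ c, ∑ e, ∑ b, f a b c e :=
        Finset.sum_congr rfl fun _ _ => Finset.sum_comm.trans
          (Finset.sum_congr rfl fun _ _ => Finset.sum_comm)
    _ = ∑ c, ∑ e, ∑ a, ∑ b, f a b c e :=
        Finset.sum_comm.trans (Finset.sum_congr rfl fun _ _ => Finset.sum_comm)

lemma isChoiPositive_smulRight {τ : A →ₗ[ℂ] ℂ} (hτ : ∀ a, 0 ≤ τ (star a * a))
    {G : CStarMatrix (Fin n) (Fin n) ℂ} (hG : 0 ≤ G) : IsChoiPositive (τ.smulRight G) := by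
  intro b
  obtain ⟨D, rfl⟩ := exists_eq_star_mul_self_of_nonneg hG
  have h : ∑ r, ∑ s, (τ.smulRight (star D * D)) (star (b r) * b s) r s =
      ∑ l, τ (star (∑ r, D l r • b r) * ∑ s, D l s • b s) := by
    simp only [star_sum, Finset.sum_mul, Finset.mul_sum, map_sum, star_smul, smul_mul_smul_comm,
      map_smul, LinearMap.smulRight_apply, CStarMatrix.smul_apply, CStarMatrix.mul_apply,
      CStarMatrix.star_apply, smul_eq_mul]
    refine Eq.trans (Finset.sum_congr rfl fun r _ => Finset.sum_comm) (Finset.sum_comm.trans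
      (Finset.sum_congr rfl fun l _ => Eq.trans ?_ Finset.sum_comm))
    refine Finset.sum_congr rfl fun r _ => Finset.sum_congr rfl fun s _ => ?_
    ring
  rw [h]
  exact Finset.sum_nonneg fun l _ => hτ _

/-- The compression `a ↦ R* φ(a) R`. -/
noncomputable def compression (φ : A →ₗ[ℂ] CStarMatrix (Fin n) (Fin n) ℂ)
    (R : CStarMatrix (Fin n) (Fin n) ℂ) : A →ₗ[ℂ] CStarMatrix (Fin n) (Fin n) ℂ where
  toFun a := star R * φ a * R
  map_add' a b := by simp [mul_add, add_mul]
  map_smul' c a := by simp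

lemma IsChoiPositive.compress (hφ : IsChoiPositive φ) (R : CStarMatrix (Fin n) (Fin n) ℂ) :
    IsChoiPositive (compression φ R) := by
  intro b
  have h : ∑ r, ∑ s, compression φ R (star (b r) * b s) r s =
      ∑ p, ∑ q, φ (star (∑ r, R p r • b r) * ∑ s, R q s • b s) p q := by
    have h0 : ∀ a r s, compression φ R a r s =
        ∑ p, ∑ q, star (R p r) * φ a p q * R q s := fun a r s => by
      change (star R * φ a * R) r s = _
      simp only [CStarMatrix.mul_apply, CStarMatrix.star_apply, Finset.sum_mul]
      exact Finset.sum_comm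
    simp only [h0, star_sum, Finset.sum_mul, Finset.mul_sum, map_sum, star_smul,
      smul_mul_smul_comm, map_smul, CStarMatrix.smul_apply, CStarMatrix.sum_apply, smul_eq_mul]
    rw [sum_sum_comm_pairs]
    refine Finset.sum_congr rfl fun p _ => Finset.sum_congr rfl fun q _ => ?_
    rw [Finset.sum_comm]
    refine Finset.sum_congr rfl fun r _ => Finset.sum_congr rfl fun s _ => ?_
    ring
  rw [h]
  exact hφ _

/-- A unital Choi-positive map produces a point of the matrix range. -/
lemma IsChoiPositive.mem_matrixRange {d : ℕ} (hφ : IsChoiPositive φ) (h1 : φ 1 = 1)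
    (ξ : Fin d → A) : (fun i => φ (ξ i)) ∈ matrixRange n ξ :=
  ⟨hφ.toCompletelyPositiveMap, h1, fun _ => rfl⟩

/-- The constant `4` comes from the decomposition into four positive elements; it is not optimal. -/
lemma norm_apply_le_of_unital (Φ : A →CP CStarMatrix (Fin n) (Fin n) ℂ) (h1 : Φ 1 = 1) (a : A) :
    ‖Φ a‖ ≤ 4 * ‖a‖ := by
  have hpos : ∀ x : A, 0 ≤ x → ‖Φ x‖ ≤ ‖x‖ := fun x hx => by
    have h2 : Φ x ≤ Φ ((‖x‖ : ℂ) • 1) :=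
      OrderHomClass.mono Φ ((IsSelfAdjoint.of_nonneg hx).le_smul_one le_rfl)
    rw [map_smul, h1] at h2
    exact norm_le_of_le_smul_one (map_nonneg Φ hx) (norm_nonneg x) h2
  obtain ⟨y, hy0, hy1, hy⟩ := CStarAlgebra.exists_sum_four_nonneg a
  calc ‖Φ a‖ = ‖∑ i : Fin 4, Complex.I ^ (i : ℕ) • Φ (y i)‖ := by
        conv_lhs => rw [hy]
        simp
    _ ≤ ∑ i : Fin 4, ‖a‖ := norm_sum_le_of_le _ fun i _ => by
        simpa [norm_smul] using (hpos _ (hy0 i)).trans (hy1 i)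
    _ = 4 * ‖a‖ := by simp

end ChoiPositive

/-! ### Near-positivity on pencils and the matrix range -/

/-- A linear functional prescribed on the range of a linear map `P : V → B` and positive there up to
an error `δ ‖c‖` is, up to an error of the same order, the restriction of a positive functional.
The error is absorbed by extending a functional from `V × ℝ` to `B × V × ℝ` that is nonnegative on
`{(x, c, r) | 0 ≤ Re x, δ ‖c‖ ≤ r}`. -/
lemma exists_nonneg_functional_near {B V : Type*} [CStarAlgebra B] [PartialOrder B]
    [StarOrderedRing B] [NormedAddCommGroup V] [NormedSpace ℂ V] (P : V →ₗ[ℂ] B)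
    (q : V →ₗ[ℂ] ℂ) (hP : ∃ c, P c = 1) {δ : ℝ} (hδ : 0 ≤ δ)
    (hpos : ∀ c, 0 ≤ P c + star (P c) → 0 ≤ (q c).re + δ * ‖c‖) :
    ∃ ρ : B →ₗ[ℂ] ℂ, (∀ x, 0 ≤ x → 0 ≤ ρ x) ∧ ∀ c, ‖ρ (P c) - q c‖ ≤ 2 * (δ * ‖c‖) := by
  let K : PointedCone ℝ (B × V × ℝ) :=
    { carrier := {p | p.1 ∈ rePosCone B ∧ δ * ‖p.2.1‖ ≤ p.2.2}
      zero_mem' := by simp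
      add_mem' := fun {p q} hp hq => ⟨add_mem hp.1 hq.1, by
        have := mul_le_mul_of_nonneg_left (norm_add_le p.2.1 q.2.1) hδ
        have h1 := hp.2
        have h2 := hq.2
        simp only [Prod.snd_add, Prod.fst_add]
        linarith⟩
      smul_mem' := fun c p hp => ⟨Submodule.smul_mem (rePosCone B) c hp.1, by
        change δ * ‖(c : ℝ) • p.2.1‖ ≤ (c : ℝ) * p.2.2
        have := mul_le_mul_of_nonneg_left hp.2 c.2
        rw [norm_smul, Real.norm_of_nonneg c.2]
        linarith⟩ }
  have hK : ∀ p, p ∈ K ↔ p.1 ∈ rePosCone B ∧ δ * ‖p.2.1‖ ≤ p.2.2 := fun _ => Iff.rfl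
  let L : V × ℝ →ₗ[ℝ] B × V × ℝ :=
    ((P.restrictScalars ℝ) ∘ₗ LinearMap.fst ℝ V ℝ).prod LinearMap.id
  let ℓ : V × ℝ →ₗ[ℝ] ℝ :=
    (Complex.reLm ∘ₗ q.restrictScalars ℝ).coprod LinearMap.id
  have hL : ∀ p, L p = (P p.1, p) := fun _ => rfl
  have hℓ : ∀ p, ℓ p = (q p.1).re + p.2 := fun _ => rfl
  obtain ⟨g, hgL, hgK⟩ := exists_nonneg_extension K L ℓ
    (fun p hp => by
      rw [hL, hK] at hp
      rw [hℓ]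
      linarith [hpos p.1 hp.1, hp.2])
    (fun ⟨x, c, r⟩ => by
      obtain ⟨s, hs⟩ := exists_algebraMap_add_mem_rePosCone x
      obtain ⟨e₁, he₁⟩ := hP
      obtain ⟨e, he⟩ : ∃ e, P e = algebraMap ℝ B s := ⟨(s : ℂ) • e₁, by
        rw [map_smul, he₁, Complex.coe_smul, Algebra.algebraMap_eq_smul_one]⟩
      refine ⟨(e, δ * ‖e + c‖ - r), ?_⟩
      rw [hL, hK]
      refine ⟨?_, ?_⟩
      · simpa [he] using hs
      · simp)
  let g₁ : B →ₗ[ℝ] ℝ := g ∘ₗ LinearMap.inl ℝ B (V × ℝ)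
  have hg₁ : ∀ x ∈ rePosCone B, 0 ≤ g₁ x := fun x hx => hgK _ ((hK _).2 ⟨hx, by simp⟩)
  have hest : ∀ c : V, |g₁ (P c) - (q c).re| ≤ δ * ‖c‖ := fun c => by
    have h1 : g (P c, c, δ * ‖c‖) = (q c).re + δ * ‖c‖ :=
      hgL (c, δ * ‖c‖)
    have h2 : g (P c, c, -(δ * ‖c‖)) = (q c).re + -(δ * ‖c‖) :=
      hgL (c, -(δ * ‖c‖))
    have h3 : 0 ≤ g (0, c, δ * ‖c‖) := hgK _ ((hK _).2 ⟨zero_mem _, le_rfl⟩)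
    have h4 : 0 ≤ g (0, -c, δ * ‖c‖) := hgK _ ((hK _).2 ⟨zero_mem _, by simp⟩)
    have h5 : g (P c, c, δ * ‖c‖) = g₁ (P c) + g (0, c, δ * ‖c‖) := by
      simp [g₁, ← map_add]
    have h6 : g (P c, c, -(δ * ‖c‖)) = g₁ (P c) - g (0, -c, δ * ‖c‖) := by
      have h7 : ((P c, c, -(δ * ‖c‖)) : B × V × ℝ) = (P c, 0, 0) - (0, -c, δ * ‖c‖) := by simp
      rw [h7, map_sub]
      rfl
    rw [abs_le]
    constructor <;> linarith
  let ρ : B →ₗ[ℂ] ℂ := Module.Dual.extendRCLike g₁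
  have hρ : ∀ c : V, ‖ρ (P c) - q c‖ ≤ 2 * (δ * ‖c‖) := fun c => by
    refine (Complex.norm_le_abs_re_add_abs_im _).trans ?_
    have h1 : (ρ (P c)).re = g₁ (P c) := Module.Dual.re_extendRCLike_apply (𝕜 := ℂ) g₁ _
    have h2 : (ρ (P c)).im = -g₁ (Complex.I • P c) :=
      Module.Dual.im_extendRCLike_apply (𝕜 := ℂ) g₁ _
    have h3 := hest c
    have h4 := hest (Complex.I • c)
    rw [map_smul P, map_smul q, norm_smul, Complex.norm_I, one_mul] at h4
    have h5 : (Complex.I • q c).re = -(q c).im := by simp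
    rw [h5, sub_neg_eq_add] at h4
    rw [Complex.sub_re, Complex.sub_im, h1, h2, ← abs_neg (-_ - _), neg_sub, sub_neg_eq_add,
      add_comm (q c).im]
    linarith
  exact ⟨ρ, fun x hx => extendRCLike_nonneg hg₁ hx, hρ⟩

section Pencil

variable {A : Type*} [CStarAlgebra A] [PartialOrder A] [StarOrderedRing A] {n : ℕ}
  {κ : Type*} [Fintype κ] [DecidableEq κ]

/-- The linear matrix pencil with coefficients `c`, evaluated at the family `η`. -/
noncomputable def pencil (η : κ → A) :
    (Fin n → Fin n → κ → ℂ) →ₗ[ℂ] CStarMatrix (Fin n) (Fin n) A where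
  toFun c := CStarMatrix.ofMatrix fun i j => ∑ k, c i j k • η k
  map_add' c e := by
    ext i j
    refine Eq.trans ?_ Finset.sum_add_distrib
    exact Finset.sum_congr rfl fun k _ => add_smul _ _ _
  map_smul' a c := by
    ext i j
    change ∑ k, (a * c i j k) • η k = a • ∑ k, c i j k • η k
    simp [Finset.smul_sum, mul_smul]

lemma pencil_apply (η : κ → A) (c : Fin n → Fin n → κ → ℂ) (i j : Fin n) :
    pencil η c i j = ∑ k, c i j k • η k := rfl

/-- The pairing of the coefficients of a pencil with a family of matrices, the value at the pencil
of the functional `∑ φ(·_ij)_ij` attached to a map `φ` that takes the family `η` to `X`. -/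
noncomputable def pencilPairing (X : κ → CStarMatrix (Fin n) (Fin n) ℂ) :
    (Fin n → Fin n → κ → ℂ) →ₗ[ℂ] ℂ where
  toFun c := ∑ i, ∑ j, ∑ k, c i j k * X k i j
  map_add' c e := by simp [add_mul, Finset.sum_add_distrib]
  map_smul' a c := by simp [Finset.mul_sum, mul_assoc]

lemma pencilPairing_apply (X : κ → CStarMatrix (Fin n) (Fin n) ℂ) (c : Fin n → Fin n → κ → ℂ) :
    pencilPairing X c = ∑ i, ∑ j, ∑ k, c i j k * X k i j := rfl

/-- The coefficients of the pencil whose only nonzero coefficient is `1`, at `(i, j, k)`. -/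
def pencilUnit (i j : Fin n) (k : κ) : Fin n → Fin n → κ → ℂ :=
  Pi.single i (Pi.single j (Pi.single k 1))

lemma pencilUnit_apply (i j i' j' : Fin n) (k k' : κ) :
    pencilUnit i j k i' j' k' = if i = i' ∧ j = j' ∧ k = k' then 1 else 0 := by
  unfold pencilUnit
  by_cases hi : i = i'
  · subst hi
    by_cases hj : j = j'
    · subst hj
      by_cases hk : k = k'
      · subst hk; simp
      · simp [hk, Ne.symm hk]
    · simp [hj, eq_comm]
  · simp [hi, eq_comm]

lemma norm_pencilUnit_le (i j : Fin n) (k : κ) :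
    ‖(pencilUnit i j k : Fin n → Fin n → κ → ℂ)‖ ≤ 1 := by
  refine (pi_norm_le_iff_of_nonneg zero_le_one).2 fun i' =>
    (pi_norm_le_iff_of_nonneg zero_le_one).2 fun j' =>
      (pi_norm_le_iff_of_nonneg zero_le_one).2 fun k' => ?_
  rw [pencilUnit_apply]
  split_ifs <;> simp

lemma pencil_pencilUnit (η : κ → A) (i j : Fin n) (k : κ) :
    pencil η (pencilUnit i j k) = CStarMatrix.single i j (η k) := by
  ext i' j'
  rw [pencil_apply, CStarMatrix.single_apply]
  by_cases h : i = i' ∧ j = j'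
  · simp [pencilUnit_apply, h]
  · simp [pencilUnit_apply, ← and_assoc, h]

lemma pencilPairing_pencilUnit (X : κ → CStarMatrix (Fin n) (Fin n) ℂ) (i j : Fin n) (k : κ) :
    pencilPairing X (pencilUnit i j k) = X k i j := by
  simp [pencilPairing_apply, pencilUnit_apply, ite_and]

lemma exists_pencil_eq_one {η : κ → A} {k₀ : κ} (hη : η k₀ = 1) :
    ∃ c : Fin n → Fin n → κ → ℂ, pencil η c = 1 := by
  refine ⟨∑ i, pencilUnit i i k₀, ?_⟩
  rw [map_sum]
  simp only [pencil_pencilUnit, hη]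
  ext i j
  rw [CStarMatrix.sum_apply]
  simp [CStarMatrix.single_apply, CStarMatrix.one_apply, ite_and]

/-- If the linear map of pencils sending `η` to `X` is positive up to an error `δ`, then a
completely positive map takes `η` to `X` up to an error `2 δ`. -/
lemma exists_isChoiPositive_near {η : κ → A} {k₀ : κ} (hη : η k₀ = 1)
    (X : κ → CStarMatrix (Fin n) (Fin n) ℂ) {δ : ℝ} (hδ : 0 ≤ δ)
    (hpos : ∀ c : Fin n → Fin n → κ → ℂ, 0 ≤ pencil η c + star (pencil η c) →
      0 ≤ (pencilPairing X c).re + δ * ‖c‖) :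
    ∃ φ : A →ₗ[ℂ] CStarMatrix (Fin n) (Fin n) ℂ, IsChoiPositive φ ∧
      ∀ k i j, ‖φ (η k) i j - X k i j‖ ≤ 2 * δ := by
  obtain ⟨ρ, hρ0, hρ⟩ := exists_nonneg_functional_near (pencil η) (pencilPairing X)
    (exists_pencil_eq_one hη) hδ hpos
  refine ⟨choiMap ρ, isChoiPositive_choiMap hρ0, fun k i j => ?_⟩
  have h := hρ (pencilUnit i j k)
  rw [pencil_pencilUnit, pencilPairing_pencilUnit] at h
  have h' := mul_le_mul_of_nonneg_left (norm_pencilUnit_le i j k) hδ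
  rw [choiMap_apply]
  linarith

end Pencil

section NearUnital

variable {A : Type*} [CStarAlgebra A] [PartialOrder A] [StarOrderedRing A] {n d : ℕ}

/-- The family `1, ξ_1, …, ξ_d`. -/
def withOne {R : Type*} [One R] (ξ : Fin d → R) : Option (Fin d) → R := fun k => k.elim 1 ξ

lemma norm_one_le_one (B : Type*) [CStarAlgebra B] : ‖(1 : B)‖ ≤ 1 := by
  rcases subsingleton_or_nontrivial B with h | h
  · simp [Subsingleton.elim (1 : B) 0]
  · simp

/-- A Choi-positive map that is nearly unital is made unital by adding `τ(·) G`, where `τ` is a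
state and `G` a small positive matrix, and rescaling. -/
lemma IsChoiPositive.exists_mem_matrixRange_near (hn : 1 ≤ n)
    {φ : A →ₗ[ℂ] CStarMatrix (Fin n) (Fin n) ℂ} (hφ : IsChoiPositive φ) (ξ : Fin d → A)
    (X : Fin d → CStarMatrix (Fin n) (Fin n) ℂ) {R ε : ℝ} (hε : 0 ≤ ε) (hε' : ε ≤ 1 / 2)
    (hX : ∀ k i j, ‖X k i j‖ ≤ R)
    (hφX : ∀ k i j, ‖φ (withOne ξ k) i j - withOne X k i j‖ ≤ ε) :
    ∃ Y ∈ matrixRange n ξ, ∀ k i j, ‖Y k i j - X k i j‖ ≤ (1 + (n : ℝ) ^ 2 * (5 * R + 2)) * ε := by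
  let i₀ : Fin n := ⟨0, hn⟩
  have h1 : ∀ i j, ‖(φ 1 - 1) i j‖ ≤ ε := hφX none
  have hξ : ∀ k i j, ‖φ (ξ k) i j - X k i j‖ ≤ ε := fun k => hφX (some k)
  set η : ℝ := (n : ℝ) ^ 2 * ε with hη
  have hη0 : 0 ≤ η := by positivity
  have hQ : ‖φ 1 - 1‖ ≤ η := by
    refine (CStarMatrix.norm_le_sum_norm_entry _).trans ((Finset.sum_le_sum fun i _ =>
      Finset.sum_le_sum fun j _ => h1 i j).trans ?_)
    simp [hη, sq, mul_assoc]
  have hφ1 : 0 ≤ φ 1 :=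
    map_nonneg hφ.toCompletelyPositiveMap (zero_le_one (α := A))
  -- the defect of `φ 1` from `1 + η`
  set G : CStarMatrix (Fin n) (Fin n) ℂ := ((1 + η : ℝ) : ℂ) • 1 - φ 1 with hG
  have hG0 : 0 ≤ G := by
    have hsa : IsSelfAdjoint (φ 1 - 1) := (IsSelfAdjoint.of_nonneg hφ1).sub (.one _)
    have h2 := sub_nonneg.2 (hsa.le_smul_one hQ)
    convert h2 using 1
    rw [hG, Complex.ofReal_add, add_smul]
    simp
    abel
  have hGij : ∀ i j, ‖G i j‖ ≤ 2 * η := fun i j => by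
    refine CStarMatrix.norm_entry_le_norm.trans ?_
    have h2 : G = (η : ℂ) • 1 - (φ 1 - 1) := by
      rw [hG, Complex.ofReal_add, add_smul]; simp; abel
    rw [h2]
    refine (norm_sub_le _ _).trans ?_
    rw [norm_smul, Complex.norm_real, Real.norm_of_nonneg hη0]
    have := mul_le_mul_of_nonneg_left (norm_one_le_one (CStarMatrix (Fin n) (Fin n) ℂ)) hη0
    linarith
  -- the state is the normalized corner entry of `φ`
  set Q : ℂ := φ 1 i₀ i₀ with hQdef
  have hQ0 : 0 ≤ Q := by simpa using hφ.apply_diag_nonneg i₀ 1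
  have hQnorm : 1 / 2 ≤ ‖Q‖ := by
    have h2 : ‖Q - 1‖ ≤ ε := by simpa using h1 i₀ i₀
    have h3 : ‖(1 : ℂ)‖ ≤ ‖Q‖ + ‖Q - 1‖ := by
      have := norm_sub_le Q (Q - 1)
      rwa [sub_sub_cancel] at this
    rw [norm_one] at h3
    linarith
  have hQne : Q ≠ 0 := fun h => by rw [h, norm_zero] at hQnorm; norm_num at hQnorm
  let τ : A →ₗ[ℂ] ℂ := Q⁻¹ • diagEntry φ i₀
  have hτ : ∀ a, τ a = Q⁻¹ * φ a i₀ i₀ := fun _ => rfl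
  have hτ0 : ∀ a, 0 ≤ τ (star a * a) := fun a =>
    mul_nonneg (inv_nonneg.2 hQ0) (hφ.apply_diag_nonneg i₀ a)
  let c : ℂ := ((1 + η : ℝ) : ℂ)⁻¹
  have hc0 : 0 ≤ c := inv_nonneg.2 (by exact_mod_cast add_nonneg zero_le_one hη0)
  have hcne : ((1 + η : ℝ) : ℂ) ≠ 0 := by exact_mod_cast (by linarith : (1 + η : ℝ) ≠ 0)
  have hcnorm : ‖c‖ ≤ 1 := by
    rw [norm_inv, Complex.norm_real, Real.norm_of_nonneg (by linarith)]
    exact inv_le_one_of_one_le₀ (by linarith)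
  have hψ : IsChoiPositive (c • (φ + τ.smulRight G)) :=
    (hφ.add (isChoiPositive_smulRight hτ0 hG0)).smul hc0
  have hψ1 : (c • (φ + τ.smulRight G)) 1 = 1 := by
    have h2 : τ 1 = 1 := by rw [hτ]; exact inv_mul_cancel₀ hQne
    simp only [LinearMap.smul_apply, LinearMap.add_apply, LinearMap.smulRight_apply, h2, one_smul]
    rw [hG, add_sub_cancel, smul_smul, inv_mul_cancel₀ hcne, one_smul]
  refine ⟨_, hψ.mem_matrixRange hψ1 ξ, fun k i j => ?_⟩
  have hXR : 0 ≤ R := (norm_nonneg _).trans (hX k i j)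
  have hτξ : ‖τ (ξ k)‖ ≤ 2 * (R + ε) := by
    rw [hτ, norm_mul, norm_inv]
    have h2 : ‖Q‖⁻¹ ≤ 2 := by
      rw [inv_le_comm₀ (by linarith) two_pos]; linarith
    have h3 : ‖φ (ξ k) i₀ i₀‖ ≤ R + ε := by
      have := norm_add_le (X k i₀ i₀) (φ (ξ k) i₀ i₀ - X k i₀ i₀)
      rw [add_sub_cancel] at this
      linarith [hX k i₀ i₀, hξ k i₀ i₀]
    exact mul_le_mul h2 h3 (norm_nonneg _) zero_le_two
  have hkey : (c • (φ + τ.smulRight G)) (ξ k) i j - X k i j =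
      c * ((φ (ξ k) i j - X k i j) - (η : ℂ) * X k i j + τ (ξ k) * G i j) := by
    have h2 : (c • (φ + τ.smulRight G)) (ξ k) i j = c * (φ (ξ k) i j + τ (ξ k) * G i j) := rfl
    have h3 : X k i j = c * (((1 + η : ℝ) : ℂ) * X k i j) := by
      rw [← mul_assoc, inv_mul_cancel₀ hcne, one_mul]
    rw [h2]
    conv_lhs => rw [h3]
    push_cast
    ring
  change ‖(c • (φ + τ.smulRight G)) (ξ k) i j - X k i j‖ ≤ _
  rw [hkey, norm_mul]
  have h5 : ‖(φ (ξ k) i j - X k i j) - (η : ℂ) * X k i j + τ (ξ k) * G i j‖ ≤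
      ε + η * R + 2 * (R + ε) * (2 * η) := by
    refine (norm_add_le _ _).trans (add_le_add ((norm_sub_le _ _).trans
      (add_le_add (hξ k i j) ?_)) ?_)
    · rw [norm_mul, Complex.norm_real, Real.norm_of_nonneg hη0]
      exact mul_le_mul_of_nonneg_left (hX k i j) hη0
    · rw [norm_mul]
      exact mul_le_mul hτξ (hGij i j) (norm_nonneg _) (by linarith)
  calc ‖c‖ * _ ≤ 1 * (ε + η * R + 2 * (R + ε) * (2 * η)) :=
        mul_le_mul hcnorm h5 (norm_nonneg _) zero_le_one
    _ ≤ (1 + (n : ℝ) ^ 2 * (5 * R + 2)) * ε := by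
        have h6 : η * ε ≤ η * (1 / 2) := mul_le_mul_of_nonneg_left hε' hη0
        have h7 : (1 + (n : ℝ) ^ 2 * (5 * R + 2)) * ε = ε + 5 * (η * R) + 2 * η := by
          rw [hη]; ring
        rw [h7]
        linarith

/-- If the linear map of pencils sending `ξ` to `X` is unital and positive up to an error `δ`, then
`X` is at distance of order `δ` from the matrix range of `ξ`. -/
lemma exists_mem_matrixRange_near (hn : 1 ≤ n) (ξ : Fin d → A)
    (X : Fin d → CStarMatrix (Fin n) (Fin n) ℂ) {R δ : ℝ} (hδ : 0 ≤ δ) (hδ' : δ ≤ 1 / 4)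
    (hX : ∀ k i j, ‖X k i j‖ ≤ R)
    (hpos : ∀ c : Fin n → Fin n → Option (Fin d) → ℂ,
      0 ≤ pencil (withOne ξ) c + star (pencil (withOne ξ) c) →
        0 ≤ (pencilPairing (withOne X) c).re + δ * ‖c‖) :
    ∃ Y ∈ matrixRange n ξ, ∀ k i j,
      ‖Y k i j - X k i j‖ ≤ (1 + (n : ℝ) ^ 2 * (5 * R + 2)) * (2 * δ) := by
  obtain ⟨φ, hφ, hφX⟩ := exists_isChoiPositive_near (k₀ := none) rfl (withOne X) hδ hpos
  exact hφ.exists_mem_matrixRange_near hn ξ X (by linarith) (by linarith) hX hφX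

end NearUnital

/-! ### Positivity of pencils and their norms -/

section CompletelyPositiveMap

variable {A : Type*} [CStarAlgebra A] [PartialOrder A] [StarOrderedRing A] {n : ℕ}

lemma CompletelyPositiveMap.map_star_eq {B : Type*} [CStarAlgebra B] [PartialOrder B]
    [StarOrderedRing B] (Φ : A →CP B) (a : A) : Φ (star a) = star (Φ a) := by
  obtain ⟨y, hy0, -, hy⟩ := CStarAlgebra.exists_sum_four_nonneg a
  have h1 : ∀ i, star (y i) = y i := fun i => (IsSelfAdjoint.of_nonneg (hy0 i)).star_eq
  have h2 : ∀ i, star (Φ (y i)) = Φ (y i) := fun i =>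
    (IsSelfAdjoint.of_nonneg (map_nonneg Φ (hy0 i))).star_eq
  rw [hy]
  simp only [star_sum, star_smul, map_sum, map_smul, h1, h2]

lemma CompletelyPositiveMap.sum_apply_entry_nonneg (Φ : A →CP CStarMatrix (Fin n) (Fin n) ℂ)
    {M : CStarMatrix (Fin n) (Fin n) A} (hM : 0 ≤ M) : 0 ≤ ∑ i, ∑ j, Φ (M i j) i j := by
  have h := CStarMatrix.nonneg_iff_quadraticForm.1 (Φ.map_cstarMatrix_nonneg M hM)
    fun i r => if i = r then 1 else 0
  simpa using h

end CompletelyPositiveMap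

section Transfer

variable {n d : ℕ}

lemma sum_apply_pencil {A : Type*} [CStarAlgebra A] [PartialOrder A] [StarOrderedRing A]
    {ξ : Fin d → A} (Φ : A →CP CStarMatrix (Fin n) (Fin n) ℂ) (h1 : Φ 1 = 1)
    (c : Fin n → Fin n → Option (Fin d) → ℂ) :
    ∑ i, ∑ j, Φ (pencil (withOne ξ) c i j) i j =
      pencilPairing (withOne fun k => Φ (ξ k)) c := by
  have h : ∀ k, Φ (withOne ξ k) = withOne (fun k => Φ (ξ k)) k := fun k => by
    cases k
    · exact h1
    · rfl
  simp only [pencil_apply, map_sum, map_smul, h, CStarMatrix.sum_apply, CStarMatrix.smul_apply,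
    smul_eq_mul, pencilPairing_apply]

lemma sum_apply_star {A : Type*} [CStarAlgebra A] [PartialOrder A] [StarOrderedRing A]
    (Φ : A →CP CStarMatrix (Fin n) (Fin n) ℂ) (M : CStarMatrix (Fin n) (Fin n) A) :
    ∑ i, ∑ j, Φ (star M i j) i j = star (∑ i, ∑ j, Φ (M i j) i j) := by
  simp only [CStarMatrix.star_apply, Φ.map_star_eq, star_sum]
  exact Finset.sum_comm

/-- The real part of a pencil, doubled. -/
noncomputable def rePencil {A : Type*} [CStarAlgebra A] [PartialOrder A] [StarOrderedRing A]
    (ξ : Fin d → A) (c : Fin n → Fin n → Option (Fin d) → ℂ) : CStarMatrix (Fin n) (Fin n) A :=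
  pencil (withOne ξ) c + star (pencil (withOne ξ) c)

lemma isSelfAdjoint_rePencil {A : Type*} [CStarAlgebra A] [PartialOrder A] [StarOrderedRing A]
    (ξ : Fin d → A) (c : Fin n → Fin n → Option (Fin d) → ℂ) : IsSelfAdjoint (rePencil ξ c) :=
  IsSelfAdjoint.add_star_self _

lemma nonneg_add_smul_one_of_norm_le {B : Type*} [CStarAlgebra B] [PartialOrder B]
    [StarOrderedRing B] {h : B} (hsa : IsSelfAdjoint h) {R δ : ℝ}
    (hR : ‖(R : ℂ) • 1 - h‖ ≤ R + δ) : 0 ≤ h + (δ : ℂ) • 1 := by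
  have hsa' : IsSelfAdjoint ((R : ℂ) • 1 - h) := by
    rw [← algebraMap_real_eq_complex_smul]
    exact (IsSelfAdjoint.algebraMap B (.all R)).sub hsa
  have h2 := sub_nonneg.2 (hsa'.le_smul_one hR)
  convert h2 using 1
  rw [Complex.ofReal_add, add_smul]
  abel

lemma norm_smul_one_sub_le_of_nonneg {B : Type*} [CStarAlgebra B] [PartialOrder B]
    [StarOrderedRing B] {h : B} (h0 : 0 ≤ h) {R : ℝ} (hR : ‖h‖ ≤ R) :
    ‖(R : ℂ) • 1 - h‖ ≤ R := by
  have h1 := (IsSelfAdjoint.of_nonneg h0).le_smul_one hR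
  exact norm_le_of_le_smul_one (sub_nonneg.2 h1) ((norm_nonneg h).trans hR) (sub_le_self _ h0)

/-- A point of the matrix range of `ξ` satisfies the near-positivity condition for `ζ` when the
norms of the self-adjoint pencils at `ξ` and at `ζ` are close, uniformly over unit coefficients. -/
lemma re_pencilPairing_nonneg_of_norm_close {A B : Type*} [CStarAlgebra A] [PartialOrder A]
    [StarOrderedRing A] [CStarAlgebra B] [PartialOrder B] [StarOrderedRing B]
    {ξ : Fin d → A} {ζ : Fin d → B} {R δ : ℝ}
    (hR : ∀ c : Fin n → Fin n → Option (Fin d) → ℂ, ‖c‖ = 1 → ‖rePencil ζ c‖ ≤ R)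
    (hclose : ∀ c : Fin n → Fin n → Option (Fin d) → ℂ, ‖c‖ = 1 →
      ‖(R : ℂ) • 1 - rePencil ξ c‖ ≤ ‖(R : ℂ) • 1 - rePencil ζ c‖ + δ)
    {X : Fin d → CStarMatrix (Fin n) (Fin n) ℂ} (hX : X ∈ matrixRange n ξ)
    (c : Fin n → Fin n → Option (Fin d) → ℂ) (hc : 0 ≤ rePencil ζ c) :
    0 ≤ (pencilPairing (withOne X) c).re + (n * δ / 2) * ‖c‖ := by
  obtain ⟨Φ, hΦ1, hΦX⟩ := hX
  obtain rfl : (fun k => Φ (ξ k)) = X := funext hΦX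
  -- by homogeneity only coefficients of norm one matter
  have main : ∀ c : Fin n → Fin n → Option (Fin d) → ℂ, ‖c‖ = 1 → 0 ≤ rePencil ζ c →
      0 ≤ (pencilPairing (withOne fun k => Φ (ξ k)) c).re + n * δ / 2 := by
    intro c hc1 hc
    have h1 := (hclose c hc1).trans
      (add_le_add_left (norm_smul_one_sub_le_of_nonneg hc (hR c hc1)) δ)
    have h2 := Φ.sum_apply_entry_nonneg
      (nonneg_add_smul_one_of_norm_le (isSelfAdjoint_rePencil ξ c) h1)
    have h3 : ∑ i, ∑ j, Φ ((rePencil ξ c + (δ : ℂ) • 1) i j) i j =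
        pencilPairing (withOne fun k => Φ (ξ k)) c +
          star (pencilPairing (withOne fun k => Φ (ξ k)) c) + n * δ := by
      have h4 : ∀ i j, Φ ((rePencil ξ c + (δ : ℂ) • 1) i j) i j =
          Φ (pencil (withOne ξ) c i j) i j + Φ (star (pencil (withOne ξ) c) i j) i j +
            if i = j then (δ : ℂ) else 0 := fun i j => by
        rw [rePencil]
        by_cases h : i = j <;> simp [-Complex.coe_smul, h, hΦ1]
      simp only [h4, Finset.sum_add_distrib, sum_apply_star, sum_apply_pencil Φ hΦ1]
      simp
    rw [h3] at h2
    have h5 := (Complex.nonneg_iff.1 h2).1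
    simp at h5
    linarith
  rcases eq_or_ne c 0 with rfl | hne
  · simp
  · have hpos : 0 < ‖c‖ := norm_pos_iff.2 hne
    have hsmul : ∀ r : ℝ, rePencil ζ ((r : ℂ) • c) = (r : ℂ) • rePencil ζ c := fun r => by
      simp [-Complex.coe_smul, rePencil, star_smul]
    have h1 := main (((‖c‖⁻¹ : ℝ) : ℂ) • c) (by
      rw [norm_smul, Complex.norm_real, Real.norm_of_nonneg (inv_nonneg.2 hpos.le),
        inv_mul_cancel₀ hpos.ne']) (by
      rw [hsmul]
      exact smul_nonneg (by exact_mod_cast inv_nonneg.2 hpos.le) hc)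
    rw [map_smul, smul_eq_mul, Complex.re_ofReal_mul] at h1
    have h2 := mul_nonneg hpos.le h1
    rw [mul_add, ← mul_assoc, mul_inv_cancel₀ hpos.ne', one_mul] at h2
    linarith

end Transfer

/-- Pointwise convergence of uniformly Lipschitz functions is uniform on compact sets. -/
lemma eventually_forall_mem_dist_le_of_lipschitz {T V : Type*} [PseudoMetricSpace V]
    {l : Filter T} {F : T → V → ℝ} {f : V → ℝ} {S : Set V} (hS : IsCompact S) {L : ℝ}
    (hF : ∀ᶠ t in l, ∀ c e, |F t c - F t e| ≤ L * dist c e)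
    (hf : ∀ c e, |f c - f e| ≤ L * dist c e)
    (hlim : ∀ c, Tendsto (fun t => F t c) l (𝓝 (f c))) {ε : ℝ} (hε : 0 < ε) :
    ∀ᶠ t in l, ∀ c ∈ S, |F t c - f c| ≤ ε := by
  set ρ : ℝ := ε / (3 * (|L| + 1)) with hρ
  have hρ0 : 0 < ρ := by positivity
  have hLρ : ∀ x : ℝ, 0 ≤ x → x ≤ ρ → L * x ≤ ε / 3 := fun x hx0 hx => by
    calc L * x ≤ |L| * x := mul_le_mul_of_nonneg_right (le_abs_self L) hx0
      _ ≤ (|L| + 1) * ρ := by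
        exact mul_le_mul (by linarith) hx hx0 (by positivity)
      _ = ε / 3 := by rw [hρ]; field_simp
  obtain ⟨N, -, hN, hcov⟩ := hS.finite_cover_balls hρ0
  have hev : ∀ᶠ t in l, ∀ e ∈ N, |F t e - f e| < ε / 3 :=
    (eventually_all_finite hN).2 fun e _ => by
      simpa [Real.dist_eq] using Metric.tendsto_nhds.1 (hlim e) (ε / 3) (by positivity)
  filter_upwards [hF, hev] with t h1 h2 c hc
  obtain ⟨e, he, hce⟩ := Set.mem_iUnion₂.1 (hcov hc)
  have hd : dist c e ≤ ρ := (Metric.mem_ball.1 hce).le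
  have h3 := (h1 c e).trans (hLρ _ dist_nonneg hd)
  have h4 := (hf c e).trans (hLρ _ dist_nonneg hd)
  have h5 := (h2 e he).le
  rw [abs_le] at h3 h4 h5 ⊢
  constructor <;> linarith [h3.1, h3.2, h4.1, h4.2, h5.1, h5.2]

/-! ### Polynomials of degree one and the row norm -/

section Letters

variable {d : ℕ}

/-- The polynomials `1, z_1, …, z_d`. -/
def letterPoly : Option (Fin d) → StarPoly d :=
  withOne fun k => FreeAlgebra.ι ℂ (Sum.inl k)

/-- The polynomials `1, z_1*, …, z_d*`. -/
def starLetterPoly : Option (Fin d) → StarPoly d :=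
  withOne fun k => FreeAlgebra.ι ℂ (Sum.inr k)

lemma evalStarPoly_letterPoly {A : Type*} [CStarAlgebra A] (ξ : Fin d → A)
    (k : Option (Fin d)) : evalStarPoly ξ (letterPoly k) = withOne ξ k := by
  cases k <;> simp [letterPoly, withOne, evalStarPoly]

lemma evalStarPoly_starLetterPoly {A : Type*} [CStarAlgebra A] (ξ : Fin d → A)
    (k : Option (Fin d)) : evalStarPoly ξ (starLetterPoly k) = star (withOne ξ k) := by
  cases k <;> simp [starLetterPoly, withOne, evalStarPoly]

lemma one_mem_starPolyDegreeLE (m : ℕ) : (1 : StarPoly d) ∈ starPolyDegreeLE d m :=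
  Submodule.subset_span ⟨[], by simp, by simp⟩

lemma ι_mem_starPolyDegreeLE_one (x : Fin d ⊕ Fin d) :
    FreeAlgebra.ι ℂ x ∈ starPolyDegreeLE d 1 :=
  Submodule.subset_span ⟨[x], by simp, by simp⟩

lemma letterPoly_mem (k : Option (Fin d)) : letterPoly k ∈ starPolyDegreeLE d 1 := by
  cases k
  · exact one_mem_starPolyDegreeLE 1
  · exact ι_mem_starPolyDegreeLE_one _

lemma starLetterPoly_mem (k : Option (Fin d)) : starLetterPoly k ∈ starPolyDegreeLE d 1 := by
  cases k
  · exact one_mem_starPolyDegreeLE 1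
  · exact ι_mem_starPolyDegreeLE_one _

end Letters

section RowNorm

variable {n d : ℕ}

lemma norm_entry_le_rowNorm (X : Fin d → CStarMatrix (Fin n) (Fin n) ℂ) (k : Fin d)
    (i j : Fin n) : ‖X k i j‖ ≤ rowNorm X := by
  refine CStarMatrix.norm_entry_le_norm.trans (Real.le_sqrt_of_sq_le ?_)
  rw [sq, ← CStarRing.norm_self_mul_star]
  have h : X k * star (X k) ≤ ∑ i, X i * star (X i) :=
    Finset.single_le_sum (f := fun i => X i * star (X i)) (fun i _ => mul_star_self_nonneg (X i))
      (Finset.mem_univ k)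
  exact CStarAlgebra.norm_le_norm_of_nonneg_of_le (mul_star_self_nonneg (X k)) h

lemma rowNorm_le_of_entry_le {X : Fin d → CStarMatrix (Fin n) (Fin n) ℂ} {e : ℝ}
    (he : 0 ≤ e) (hX : ∀ k i j, ‖X k i j‖ ≤ e) : rowNorm X ≤ √d * ((n : ℝ) ^ 2 * e) := by
  have h1 : ∀ k, ‖X k‖ ≤ (n : ℝ) ^ 2 * e := fun k => by
    refine (CStarMatrix.norm_le_sum_norm_entry _).trans ((Finset.sum_le_sum fun i _ =>
      Finset.sum_le_sum fun j _ => hX k i j).trans ?_)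
    simp [sq, mul_assoc]
  rw [← Real.sqrt_sq (by positivity : 0 ≤ (n : ℝ) ^ 2 * e), ← Real.sqrt_mul (by positivity)]
  refine Real.sqrt_le_sqrt ?_
  refine (norm_sum_le _ _).trans ((Finset.sum_le_sum fun k _ => ?_).trans
    (b := ∑ _k : Fin d, ((n : ℝ) ^ 2 * e) ^ 2) (by simp))
  calc ‖X k * star (X k)‖ = ‖X k‖ * ‖X k‖ := CStarRing.norm_self_mul_star
    _ ≤ ((n : ℝ) ^ 2 * e) ^ 2 := by
      rw [sq]
      exact mul_self_le_mul_self (norm_nonneg _) (h1 k)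

lemma rowHausdorffDist_le {E F : Set (Fin d → CStarMatrix (Fin n) (Fin n) ℂ)} {ε : ℝ}
    (h1 : ∀ x ∈ E, ∃ y ∈ F, rowNorm (x - y) ≤ ε) (h2 : ∀ y ∈ F, ∃ x ∈ E, rowNorm (y - x) ≤ ε) :
    rowHausdorffDist E F ≤ ENNReal.ofReal ε := by
  refine max_le (iSup₂_le fun x hx => ?_) (iSup₂_le fun y hy => ?_)
  · obtain ⟨y, hy, hxy⟩ := h1 x hx
    exact iInf₂_le_of_le y hy (ENNReal.ofReal_le_ofReal hxy)
  · obtain ⟨x, hx, hxy⟩ := h2 y hy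
    exact iInf₂_le_of_le x hx (ENNReal.ofReal_le_ofReal hxy)

lemma exists_rowNorm_lt_of_rowHausdorffDist_lt
    {E F : Set (Fin d → CStarMatrix (Fin n) (Fin n) ℂ)} {ε : ℝ}
    (h : rowHausdorffDist E F < ENNReal.ofReal ε) :
    (∀ x ∈ E, ∃ y ∈ F, rowNorm (x - y) < ε) ∧ ∀ y ∈ F, ∃ x ∈ E, rowNorm (y - x) < ε := by
  obtain ⟨h1, h2⟩ := max_lt_iff.1 h
  constructor
  · intro x hx
    have h3 := ((le_iSup₂ (f := fun x (_ : x ∈ E) =>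
      ⨅ y ∈ F, ENNReal.ofReal (rowNorm (x - y))) x hx).trans_lt h1)
    simp only [iInf_lt_iff] at h3
    obtain ⟨y, hy, hxy⟩ := h3
    exact ⟨y, hy, (ENNReal.ofReal_lt_ofReal_iff_of_nonneg (Real.sqrt_nonneg _)).1 hxy⟩
  · intro y hy
    have h3 := ((le_iSup₂ (f := fun y (_ : y ∈ F) =>
      ⨅ x ∈ E, ENNReal.ofReal (rowNorm (y - x))) y hy).trans_lt h2)
    simp only [iInf_lt_iff] at h3
    obtain ⟨x, hx, hxy⟩ := h3
    exact ⟨x, hx, (ENNReal.ofReal_lt_ofReal_iff_of_nonneg (Real.sqrt_nonneg _)).1 hxy⟩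

end RowNorm

/-! ### Convergence of pencil norms implies convergence of matrix ranges -/

section PencilNorm

variable {A : Type*} [CStarAlgebra A] [PartialOrder A] [StarOrderedRing A] {n d : ℕ}

lemma norm_pencil_le {ξ : Fin d → A} {M : ℝ} (hM1 : 1 ≤ M) (hM : ∀ k, ‖ξ k‖ ≤ M)
    (c : Fin n → Fin n → Option (Fin d) → ℂ) :
    ‖pencil (withOne ξ) c‖ ≤ (n : ℝ) ^ 2 * ((d + 1) * M) * ‖c‖ := by
  have h1 : ∀ k, ‖withOne ξ k‖ ≤ M := fun k => by
    cases k
    · exact (norm_one_le_one A).trans hM1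
    · exact hM _
  have h2 : ∀ i j k, ‖c i j k‖ ≤ ‖c‖ := fun i j k =>
    (norm_le_pi_norm (c i j) k).trans ((norm_le_pi_norm (c i) j).trans (norm_le_pi_norm c i))
  have h3 : ∀ i j, ‖pencil (withOne ξ) c i j‖ ≤ (d + 1) * M * ‖c‖ := fun i j => by
    rw [pencil_apply]
    refine (norm_sum_le_of_le (f := fun k => c i j k • withOne ξ k) (n := fun _ => ‖c‖ * M) _
      fun k _ => ?_).trans ?_
    · rw [norm_smul]
      exact mul_le_mul (h2 i j k) (h1 k) (norm_nonneg _) (norm_nonneg _)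
    · simp
      linarith
  refine (CStarMatrix.norm_le_sum_norm_entry _).trans ((Finset.sum_le_sum fun i _ =>
      Finset.sum_le_sum fun j _ => h3 i j).trans ?_)
  simp only [Finset.sum_const, Finset.card_univ, Fintype.card_fin, nsmul_eq_mul]
  linarith

lemma norm_rePencil_le {ξ : Fin d → A} {M : ℝ} (hM1 : 1 ≤ M) (hM : ∀ k, ‖ξ k‖ ≤ M)
    (c : Fin n → Fin n → Option (Fin d) → ℂ) :
    ‖rePencil ξ c‖ ≤ 2 * ((n : ℝ) ^ 2 * ((d + 1) * M)) * ‖c‖ := by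
  have h := norm_pencil_le hM1 hM c
  refine (norm_add_le _ _).trans ?_
  rw [norm_star]
  linarith

lemma abs_norm_sub_rePencil_sub_le {ξ : Fin d → A} {M : ℝ} (hM1 : 1 ≤ M) (hM : ∀ k, ‖ξ k‖ ≤ M)
    (R : ℝ) (c e : Fin n → Fin n → Option (Fin d) → ℂ) :
    |‖(R : ℂ) • 1 - rePencil ξ c‖ - ‖(R : ℂ) • 1 - rePencil ξ e‖| ≤
      2 * ((n : ℝ) ^ 2 * ((d + 1) * M)) * dist c e := by
  refine (abs_norm_sub_norm_le _ _).trans ?_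
  have h : (R : ℂ) • 1 - rePencil ξ c - ((R : ℂ) • 1 - rePencil ξ e) = rePencil ξ (e - c) := by
    simp only [rePencil, map_sub, star_sub]
    abel
  rw [h, dist_comm, dist_eq_norm]
  exact norm_rePencil_le hM1 hM _

/-- Differences `R - (L + L*)`, for pencils `L`, are values of `*`-polynomials of degree one. -/
lemma exists_evalMatrixStarPoly_eq_sub_rePencil (R : ℝ)
    (c : Fin n → Fin n → Option (Fin d) → ℂ) :
    ∃ p : Matrix (Fin n) (Fin n) (StarPoly d), (∀ i j, p i j ∈ starPolyDegreeLE d 1) ∧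
      ∀ (A : Type u) [CStarAlgebra A] [PartialOrder A] [StarOrderedRing A] (ξ : Fin d → A),
        evalMatrixStarPoly ξ p = (R : ℂ) • 1 - rePencil ξ c := by
  refine ⟨Matrix.of fun i j => ((R : ℂ) * if i = j then 1 else 0) • letterPoly none -
    (∑ k, c i j k • letterPoly k + ∑ k, star (c j i k) • starLetterPoly k), fun i j => ?_,
    fun A _ _ _ ξ => ?_⟩
  · rw [Matrix.of_apply]
    exact sub_mem (Submodule.smul_mem _ _ (letterPoly_mem _))
      (add_mem (sum_mem fun k _ => Submodule.smul_mem _ _ (letterPoly_mem _))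
        (sum_mem fun k _ => Submodule.smul_mem _ _ (starLetterPoly_mem _)))
  · ext i j
    rw [evalMatrixStarPoly_apply, Matrix.of_apply, CStarMatrix.sub_apply, CStarMatrix.smul_apply,
      CStarMatrix.one_apply, rePencil, CStarMatrix.add_apply, CStarMatrix.star_apply, pencil_apply,
      pencil_apply]
    simp only [map_sub, map_add, map_sum, map_smul, evalStarPoly_letterPoly,
      evalStarPoly_starLetterPoly, star_sum, star_smul]
    by_cases h : i = j <;> simp [-Complex.coe_smul, h, withOne]

end PencilNorm

section PencilToRange

variable {d : ℕ} {T : Type*} [MetricSpace T] {A : T → Type u} [∀ t, CStarAlgebra (A t)]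
  [∀ t, PartialOrder (A t)] [∀ t, StarOrderedRing (A t)]
  {ξ : (t : T) → Fin d → A t} {t₀ : T}

lemma PencilNormConvergence.tendsto_norm (h : PencilNormConvergence ξ t₀) (k : Fin d) :
    Tendsto (fun t => ‖ξ t k‖) (𝓝 t₀) (𝓝 ‖ξ t₀ k‖) := by
  have h1 := h 1 le_rfl (fun _ _ => letterPoly (some k)) fun _ _ => letterPoly_mem _
  simp only [norm_evalMatrixStarPoly_const, evalStarPoly_letterPoly] at h1
  exact h1

lemma PencilNormConvergence.matrixRangeConvergence (h : PencilNormConvergence ξ t₀) :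
    MatrixRangeConvergence ξ t₀ := by
  intro n hn
  have hn0 : (0 : ℝ) < n := by exact_mod_cast hn
  set M : ℝ := 1 + ∑ k, ‖ξ t₀ k‖ with hMdef
  have hM1 : 1 ≤ M := le_add_of_nonneg_right (Finset.sum_nonneg fun _ _ => norm_nonneg _)
  have hMk : ∀ k, ‖ξ t₀ k‖ + 1 ≤ M := fun k => by
    have := Finset.single_le_sum (f := fun k => ‖ξ t₀ k‖) (fun _ _ => norm_nonneg _)
      (Finset.mem_univ k)
    linarith
  have hM : ∀ᶠ t in 𝓝 t₀, ∀ k, ‖ξ t k‖ ≤ M := eventually_all.2 fun k =>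
    (((h.tendsto_norm k).eventually (gt_mem_nhds (lt_add_one _))).mono
      fun t ht => ht.le.trans (hMk k))
  have hM₀ : ∀ k, ‖ξ t₀ k‖ ≤ M := fun k => by linarith [hMk k]
  -- `R` bounds the self-adjoint pencils with unit coefficients, for all `t` near `t₀`
  set R : ℝ := 2 * ((n : ℝ) ^ 2 * ((d + 1) * M)) with hRdef
  have hlim : ∀ c : Fin n → Fin n → Option (Fin d) → ℂ,
      Tendsto (fun t => ‖(R : ℂ) • 1 - rePencil (ξ t) c‖) (𝓝 t₀)
        (𝓝 ‖(R : ℂ) • 1 - rePencil (ξ t₀) c‖) := fun c => by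
    obtain ⟨p, hp, hpe⟩ := exists_evalMatrixStarPoly_eq_sub_rePencil.{u} R c
    simpa only [hpe] using h n hn p hp
  refine ENNReal.tendsto_nhds_zero.2 fun ε' hε' => ?_
  -- work with a finite positive bound
  obtain ⟨ε, hε, hεε⟩ : ∃ ε : ℝ, 0 < ε ∧ ENNReal.ofReal ε ≤ ε' := by
    obtain ⟨r, hr0, hr⟩ := ENNReal.lt_iff_exists_nnreal_btwn.1 hε'
    exact ⟨r, by simpa using hr0, by simpa using hr.le⟩
  -- near-positivity up to `δ` moves points of the matrix ranges by at most `C * δ`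
  set C : ℝ := √d * ((n : ℝ) ^ 2 * ((1 + (n : ℝ) ^ 2 * (5 * (4 * M) + 2)) * 2)) with hC
  have hC0 : 0 ≤ C := by positivity
  set δ : ℝ := min (1 / 4) (ε / (C + 1)) with hδ
  have hδ0 : 0 < δ := by positivity
  have hCδ : C * δ ≤ ε := by
    calc C * δ ≤ (C + 1) * (ε / (C + 1)) :=
          mul_le_mul (by linarith) (min_le_right _ _) hδ0.le (by linarith)
      _ = ε := by field_simp
  -- a point of one matrix range is close to the other one
  have key : ∀ s t, (∀ k, ‖ξ s k‖ ≤ M) → (∀ k, ‖ξ t k‖ ≤ M) →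
      (∀ c : Fin n → Fin n → Option (Fin d) → ℂ, ‖c‖ = 1 →
        ‖(R : ℂ) • 1 - rePencil (ξ s) c‖ ≤ ‖(R : ℂ) • 1 - rePencil (ξ t) c‖ + 2 * δ / n) →
      ∀ X ∈ matrixRange n (ξ s), ∃ Y ∈ matrixRange n (ξ t), rowNorm (X - Y) ≤ ε := by
    intro s t hs ht hst X hX
    have hXM : ∀ k i j, ‖X k i j‖ ≤ 4 * M := fun k i j => by
      obtain ⟨Φ, hΦ1, hΦX⟩ := hX
      rw [← hΦX]
      have := norm_apply_le_of_unital Φ hΦ1 (ξ s k)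
      exact CStarMatrix.norm_entry_le_norm.trans (by linarith [hs k])
    obtain ⟨Y, hY, hYX⟩ := exists_mem_matrixRange_near hn (ξ t) X hδ0.le (min_le_left _ _) hXM
      fun c hc => by
        have := re_pencilPairing_nonneg_of_norm_close (R := R)
          (fun c hc => by simpa [hc] using norm_rePencil_le hM1 ht c) hst hX c hc
        rwa [mul_div_cancel₀ _ hn0.ne', mul_div_cancel_left₀ _ (two_ne_zero' ℝ)] at this
    refine ⟨Y, hY, (rowNorm_le_of_entry_le
      (e := (1 + (n : ℝ) ^ 2 * (5 * (4 * M) + 2)) * (2 * δ)) (by positivity) fun k i j => ?_).trans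
      (le_trans (le_of_eq ?_) hCδ)⟩
    · rw [Pi.sub_apply, CStarMatrix.sub_apply, norm_sub_rev]
      exact hYX k i j
    · rw [hC]; ring
  have hunif := eventually_forall_mem_dist_le_of_lipschitz
    (isCompact_sphere (0 : Fin n → Fin n → Option (Fin d) → ℂ) 1)
    (hM.mono fun t ht => abs_norm_sub_rePencil_sub_le hM1 ht R)
    (abs_norm_sub_rePencil_sub_le hM1 hM₀ R) hlim (ε := 2 * δ / n) (by positivity)
  filter_upwards [hM, hunif] with t ht hu
  refine (rowHausdorffDist_le (key t t₀ ht hM₀ fun c hc => ?_)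
    (key t₀ t hM₀ ht fun c hc => ?_)).trans hεε
  · linarith [(abs_le.1 (hu c (by simpa using hc))).2]
  · linarith [(abs_le.1 (hu c (by simpa using hc))).1]

end PencilToRange

/-! ### Unital completely positive maps detect positivity -/

/-- An element `Q` that is bounded below is normalized by `R = Q ^ (-1 / 2)`. -/
lemma exists_star_mul_mul_eq_one {B : Type*} [CStarAlgebra B] [PartialOrder B]
    [StarOrderedRing B] {Q : B} {ε : ℝ} (hε : 0 < ε) (hQ : (ε : ℂ) • 1 ≤ Q) :
    ∃ R C : B, star R * Q * R = 1 ∧ R * C = 1 := by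
  have h0 : IsStrictlyPositive ((ε : ℂ) • (1 : B)) := by
    rw [← algebraMap_real_eq_complex_smul]
    exact ⟨algebraMap_nonneg B hε.le, (IsUnit.mk0 ε hε.ne').map (algebraMap ℝ B)⟩
  have hpos : IsStrictlyPositive Q := h0.of_le hQ
  have hR : star (Q ^ (-(1 / 2) : ℝ)) = Q ^ (-(1 / 2) : ℝ) :=
    (IsSelfAdjoint.of_nonneg CFC.rpow_nonneg).star_eq
  have h1 := CFC.conjugate_rpow_neg_one_half Q hpos
  exact ⟨Q ^ (-(1 / 2) : ℝ), Q * Q ^ (-(1 / 2) : ℝ), by rw [hR, h1], by rw [← mul_assoc, h1]⟩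

section Detect

variable {A : Type*} [CStarAlgebra A] [PartialOrder A] [StarOrderedRing A] {n : ℕ}

lemma compression_apply (φ : A →ₗ[ℂ] CStarMatrix (Fin n) (Fin n) ℂ)
    (R : CStarMatrix (Fin n) (Fin n) ℂ) (a : A) :
    compression φ R a = star R * φ a * R := rfl

/-- A self-adjoint element of `M_n(A)` that is not positive is detected by a unital completely
positive map into `M_n(ℂ)`: a positive functional that is negative at the element gives a completely
positive map `φ`, which is perturbed so that `φ(1)` becomes invertible and then normalized. -/
lemma exists_unital_not_nonneg_map {h : CStarMatrix (Fin n) (Fin n) A} (hsa : IsSelfAdjoint h)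
    (hneg : ¬ 0 ≤ h) :
    ∃ Φ : A →CP CStarMatrix (Fin n) (Fin n) ℂ, Φ 1 = 1 ∧ ¬ 0 ≤ h.map Φ := by
  obtain ⟨ρ, hρ, hρh⟩ := exists_nonneg_functional_neg hsa hneg
  have hρ1 : 0 < (ρ 1).re := by
    have h1 := hρ (h + (‖h‖ : ℂ) • 1) (by
      have := hsa.neg_smul_one_le le_rfl
      rwa [neg_le_iff_add_nonneg] at this)
    rw [map_add, map_smul, smul_eq_mul] at h1
    have h2 := (Complex.nonneg_iff.1 h1).1
    rw [Complex.add_re, Complex.re_ofReal_mul] at h2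
    by_contra! hle
    have := mul_nonpos_of_nonneg_of_nonpos (norm_nonneg h) hle
    linarith
  have hρ1' : 0 ≤ ρ 1 := hρ 1 zero_le_one
  have hφ : IsChoiPositive (choiMap ρ) := isChoiPositive_choiMap hρ
  let τ : A →ₗ[ℂ] ℂ := ∑ r, diagEntry (choiMap ρ) r
  have hτ : ∀ a, τ a = ∑ r, choiMap ρ a r r := fun a => by
    simp [τ, diagEntry]
  have hτ0 : ∀ a, 0 ≤ τ (star a * a) := fun a => by
    rw [hτ]
    exact Finset.sum_nonneg fun r _ => hφ.apply_diag_nonneg r a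
  have hτ1 : τ 1 = ρ 1 := by
    rw [hτ, ← sum_choiMap_apply ρ 1]
    refine Finset.sum_congr rfl fun r _ => ?_
    rw [Finset.sum_eq_single r (fun s _ hs => by simp [CStarMatrix.one_apply_ne hs.symm])
      (by simp)]
    simp
  -- the weight of the perturbation is small enough to keep the functional negative at `h`
  set K : ℝ := |(∑ i, τ (h i i)).re| with hK
  set δ : ℝ := -(ρ h).re / (2 * (K + 1)) with hδ
  have hK0 : 0 ≤ K := abs_nonneg _
  have hδ0 : 0 < δ := div_pos (by linarith) (by linarith)
  have hδK : δ * K < -(ρ h).re := by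
    have : δ * (2 * (K + 1)) = -(ρ h).re := by rw [hδ]; field_simp
    nlinarith
  have hδC : (0 : ℂ) ≤ δ := by exact_mod_cast hδ0.le
  set ψ : A →ₗ[ℂ] CStarMatrix (Fin n) (Fin n) ℂ :=
    choiMap ρ + (δ : ℂ) • τ.smulRight 1 with hψdef
  have hψ : IsChoiPositive ψ :=
    hφ.add ((isChoiPositive_smulRight hτ0 zero_le_one).smul hδC)
  have hψh : (∑ i, ∑ j, ψ (h i j) i j).re < 0 := by
    have h1 : ∀ i j, ψ (h i j) i j =
        choiMap ρ (h i j) i j + if i = j then δ * τ (h i j) else 0 := fun i j => by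
      by_cases hij : i = j <;>
        simp [-Complex.coe_smul, hψdef, hij]
    simp only [h1, Finset.sum_add_distrib, sum_choiMap_apply, Finset.sum_ite_eq,
      Finset.mem_univ, if_true, ← Finset.mul_sum]
    rw [Complex.add_re, Complex.re_ofReal_mul]
    have h2 := mul_le_mul_of_nonneg_left (le_abs_self (∑ i, τ (h i i)).re) hδ0.le
    linarith
  have hψ1 : ((δ * (ρ 1).re : ℝ) : ℂ) • 1 ≤ ψ 1 := by
    have h1 : (ρ 1 : ℂ) = ((ρ 1).re : ℝ) := by
      apply Complex.ext
      · simp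
      · simpa using (Complex.nonneg_iff.1 hρ1').2.symm
    have h2 : ψ 1 = choiMap ρ 1 + ((δ * (ρ 1).re : ℝ) : ℂ) • 1 := by
      simp only [hψdef, LinearMap.add_apply, LinearMap.smul_apply, LinearMap.smulRight_apply, hτ1]
      rw [smul_smul, Complex.ofReal_mul, ← h1]
    rw [h2]
    exact le_add_of_nonneg_left (map_nonneg hφ.toCompletelyPositiveMap (zero_le_one (α := A)))
  obtain ⟨R, C, hRQ, hRC⟩ := exists_star_mul_mul_eq_one (mul_pos hδ0 hρ1) hψ1
  refine ⟨(hψ.compress R).toCompletelyPositiveMap, hRQ, fun hcon => ?_⟩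
  have hform := CStarMatrix.nonneg_iff_quadraticForm.1 hcon fun i r => C r i
  have hback : ∀ a, star C * compression ψ R a * C = ψ a := fun a => by
    have hCR : star C * star R = 1 := by rw [← star_mul, hRC, star_one]
    rw [compression_apply]
    calc star C * (star R * ψ a * R) * C = (star C * star R) * ψ a * (R * C) := by
          simp only [mul_assoc]
      _ = ψ a := by rw [hCR, hRC, one_mul, mul_one]
  have hsum : ∑ i, ∑ r, star (C r i) * ∑ j, ∑ s,
      (h.map (hψ.compress R).toCompletelyPositiveMap) i j r s * C s j =
      ∑ i, ∑ j, ψ (h i j) i j := by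
    refine Finset.sum_congr rfl fun i _ => ?_
    have h3 : ∀ j, ψ (h i j) i j =
        ∑ r, star (C r i) * ∑ s, compression ψ R (h i j) r s * C s j := fun j => by
      conv_lhs => rw [← hback (h i j)]
      rw [mul_assoc, CStarMatrix.mul_apply]
      refine Finset.sum_congr rfl fun r _ => ?_
      rw [CStarMatrix.star_apply, CStarMatrix.mul_apply]
    simp only [h3, Finset.mul_sum]
    exact Finset.sum_comm
  rw [hsum] at hform
  exact absurd (Complex.nonneg_iff.1 hform).1 (not_le.2 hψh)

end Detect

/-! ### Hermitian dilation -/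

section Dilation

variable {A : Type*} [CStarAlgebra A] [PartialOrder A] [StarOrderedRing A] {m : ℕ}

/-- The `2 × 2` block matrix with the given blocks. -/
def CStarMatrix.blocks (a b c e : CStarMatrix (Fin m) (Fin m) A) :
    CStarMatrix (Fin m ⊕ Fin m) (Fin m ⊕ Fin m) A :=
  CStarMatrix.ofMatrix (Matrix.fromBlocks a b c e)

section Blocks

variable (a b c e : CStarMatrix (Fin m) (Fin m) A) (i j : Fin m)

@[simp] lemma CStarMatrix.blocks_inl_inl : blocks a b c e (.inl i) (.inl j) = a i j := rfl

@[simp] lemma CStarMatrix.blocks_inl_inr : blocks a b c e (.inl i) (.inr j) = b i j := rfl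

@[simp] lemma CStarMatrix.blocks_inr_inl : blocks a b c e (.inr i) (.inl j) = c i j := rfl

@[simp] lemma CStarMatrix.blocks_inr_inr : blocks a b c e (.inr i) (.inr j) = e i j := rfl

end Blocks

/-- The block-diagonal embedding `M_m(A) × M_m(A) → M_{2m}(A)`. -/
noncomputable def blockDiagStarHom :
    CStarMatrix (Fin m) (Fin m) A × CStarMatrix (Fin m) (Fin m) A →⋆ₙₐ[ℂ]
      CStarMatrix (Fin m ⊕ Fin m) (Fin m ⊕ Fin m) A where
  toFun x := CStarMatrix.blocks x.1 0 0 x.2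
  map_smul' c x := by
    ext (i | i) (j | j) <;> simp
  map_zero' := by
    ext (i | i) (j | j) <;> simp
  map_add' x y := by
    ext (i | i) (j | j) <;> simp
  map_mul' x y := by
    ext (i | i) (j | j) <;> simp [CStarMatrix.mul_apply]
  map_star' x := by
    ext (i | i) (j | j) <;> simp [CStarMatrix.star_apply]

lemma blockDiagStarHom_injective :
    Function.Injective (blockDiagStarHom (A := A) (m := m)) := fun x y h => by
  obtain ⟨h1, -, -, h2⟩ := Matrix.fromBlocks_inj.1 h
  exact Prod.ext h1 h2

/-- The hermitian matrix with off-diagonal blocks `a` and `a*`. -/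
noncomputable def blockDilation (a : CStarMatrix (Fin m) (Fin m) A) :
    CStarMatrix (Fin m ⊕ Fin m) (Fin m ⊕ Fin m) A :=
  CStarMatrix.blocks 0 a (star a) 0

lemma star_blockDilation (a : CStarMatrix (Fin m) (Fin m) A) :
    star (blockDilation a) = blockDilation a := by
  ext (i | i) (j | j) <;> simp [blockDilation, CStarMatrix.star_apply]

lemma blockDilation_mul_self (a : CStarMatrix (Fin m) (Fin m) A) :
    blockDilation a * blockDilation a = blockDiagStarHom (a * star a, star a * a) := by
  ext (i | i) (j | j) <;> simp [blockDilation, blockDiagStarHom, CStarMatrix.mul_apply]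

lemma norm_blockDilation (a : CStarMatrix (Fin m) (Fin m) A) : ‖blockDilation a‖ = ‖a‖ := by
  have h1 : ‖blockDilation a‖ * ‖blockDilation a‖ = ‖a‖ * ‖a‖ := by
    rw [← CStarRing.norm_self_mul_star, star_blockDilation, blockDilation_mul_self,
      NonUnitalStarAlgHom.norm_map (blockDiagStarHom (A := A) (m := m)) blockDiagStarHom_injective,
      Prod.norm_mk, CStarRing.norm_self_mul_star, CStarRing.norm_star_mul_self, max_self]
  exact (mul_self_inj (norm_nonneg _) (norm_nonneg _)).1 h1

/-- The hermitian dilation of `a`, indexed by `Fin (m + m)`. -/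
noncomputable def dilation (a : CStarMatrix (Fin m) (Fin m) A) :
    CStarMatrix (Fin (m + m)) (Fin (m + m)) A :=
  CStarMatrix.reindexₐ ℂ A finSumFinEquiv (blockDilation a)

lemma isSelfAdjoint_dilation (a : CStarMatrix (Fin m) (Fin m) A) :
    IsSelfAdjoint (dilation a) := by
  rw [IsSelfAdjoint, dilation, ← map_star, star_blockDilation]

lemma norm_dilation (a : CStarMatrix (Fin m) (Fin m) A) : ‖dilation a‖ = ‖a‖ := by
  rw [← norm_blockDilation a]
  exact NonUnitalStarAlgHom.norm_map
    (CStarMatrix.reindexₐ ℂ A (finSumFinEquiv (m := m) (n := m)))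
    (CStarMatrix.reindexₐ ℂ A finSumFinEquiv).injective _

lemma dilation_apply (a : CStarMatrix (Fin m) (Fin m) A) (x y : Fin m ⊕ Fin m) :
    dilation a (finSumFinEquiv x) (finSumFinEquiv y) = blockDilation a x y := by
  change blockDilation a (finSumFinEquiv.symm _) (finSumFinEquiv.symm _) = _
  rw [Equiv.symm_apply_apply, Equiv.symm_apply_apply]

end Dilation

/-! ### Convergence of matrix ranges implies convergence of pencil norms -/

section Compare

variable {A B : Type*} [CStarAlgebra A] [PartialOrder A] [StarOrderedRing A]
  [CStarAlgebra B] [PartialOrder B] [StarOrderedRing B] {n d : ℕ}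

lemma IsSelfAdjoint.norm_le_of_le_smul_one {C : Type*} [CStarAlgebra C] [PartialOrder C]
    [StarOrderedRing C] {x : C} (hx : IsSelfAdjoint x) {c : ℝ} (hc : 0 ≤ c)
    (h1 : x ≤ (c : ℂ) • 1) (h2 : -x ≤ (c : ℂ) • 1) : ‖x‖ ≤ c := by
  cases subsingleton_or_nontrivial C
  · rw [Subsingleton.elim x 0, norm_zero]; exact hc
  rw [← algebraMap_real_eq_complex_smul] at h1 h2
  rw [le_algebraMap_iff_spectrum_le (ha := hx)] at h1
  rw [neg_le, ← map_neg, algebraMap_le_iff_le_spectrum (ha := hx)] at h2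
  rcases CStarAlgebra.norm_or_neg_norm_mem_spectrum hx with h | h
  · exact h1 _ h
  · linarith [h2 _ h]

lemma isSelfAdjoint_ofReal_smul_one (C : Type*) [CStarAlgebra C] [PartialOrder C]
    [StarOrderedRing C] (r : ℝ) :
    IsSelfAdjoint ((r : ℂ) • (1 : C)) := by
  rw [← algebraMap_real_eq_complex_smul]
  exact IsSelfAdjoint.algebraMap _ (.all r)

lemma CompletelyPositiveMap.map_smul_one_sub {Θ : A →CP CStarMatrix (Fin n) (Fin n) ℂ}
    (h1 : Θ 1 = 1) (r : ℝ) (x : CStarMatrix (Fin n) (Fin n) A) :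
    ((r : ℂ) • 1 - x).map Θ = (r : ℂ) • 1 - x.map Θ := by
  ext i j : 2
  by_cases hij : i = j <;> simp [-Complex.coe_smul, hij, h1]

lemma CompletelyPositiveMap.isSelfAdjoint_map (Θ : A →CP CStarMatrix (Fin n) (Fin n) ℂ)
    {x : CStarMatrix (Fin n) (Fin n) A} (hx : IsSelfAdjoint x) : IsSelfAdjoint (x.map Θ) := by
  ext i j : 2
  rw [CStarMatrix.star_apply, CStarMatrix.map_apply, CStarMatrix.map_apply, ← Θ.map_star_eq,
    ← CStarMatrix.star_apply, hx.star_eq]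

/-- If the images of `a` under unital completely positive maps are images of `b` up to `δ` in
each entry, then `a` is bounded above by `‖b‖`, up to a multiple of `δ`: a unital completely
positive map detecting a failure of this would have no counterpart for `b`. -/
lemma le_smul_one_of_forall_exists_close {a : CStarMatrix (Fin n) (Fin n) A}
    {b : CStarMatrix (Fin n) (Fin n) B} (ha : IsSelfAdjoint a) (hb : IsSelfAdjoint b) {δ : ℝ}
    (h : ∀ Φ : A →CP CStarMatrix (Fin n) (Fin n) ℂ, Φ 1 = 1 →
      ∃ Ψ : B →CP CStarMatrix (Fin n) (Fin n) ℂ, Ψ 1 = 1 ∧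
        ∀ i j r s, ‖Φ (a i j) r s - Ψ (b i j) r s‖ ≤ δ) :
    a ≤ ((‖b‖ + (n : ℝ) ^ 4 * δ : ℝ) : ℂ) • 1 := by
  set c : ℝ := ‖b‖ + (n : ℝ) ^ 4 * δ
  rw [← sub_nonneg]
  by_contra hneg
  obtain ⟨Φ, hΦ1, hΦ⟩ :=
    exists_unital_not_nonneg_map ((isSelfAdjoint_ofReal_smul_one _ c).sub ha) hneg
  obtain ⟨Ψ, hΨ1, hΨ⟩ := h Φ hΦ1
  refine hΦ ?_
  rw [CompletelyPositiveMap.map_smul_one_sub hΦ1]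
  have hb' : b.map Ψ ≤ (‖b‖ : ℂ) • 1 := by
    rw [← sub_nonneg, ← CompletelyPositiveMap.map_smul_one_sub hΨ1]
    exact Ψ.map_cstarMatrix_nonneg _ (sub_nonneg.2 (hb.le_smul_one le_rfl))
  have hE : a.map Φ - b.map Ψ ≤ (((n : ℝ) ^ 4 * δ : ℝ) : ℂ) • 1 := by
    refine ((Φ.isSelfAdjoint_map ha).sub (Ψ.isSelfAdjoint_map hb)).le_smul_one ?_
    refine (CStarMatrix.norm_le_sum_norm_entry _).trans ?_
    have h3 : ∀ i j, ‖(a.map Φ - b.map Ψ) i j‖ ≤ (n : ℝ) ^ 2 * δ := fun i j => by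
      refine (CStarMatrix.norm_le_sum_norm_entry _).trans ((Finset.sum_le_sum fun r _ =>
        Finset.sum_le_sum fun s _ => hΨ i j r s).trans ?_)
      simp [sq, mul_assoc]
    refine (Finset.sum_le_sum fun i _ => Finset.sum_le_sum fun j _ => h3 i j).trans ?_
    simp
    apply le_of_eq; ring
  have := add_le_add hb' hE
  rw [add_sub_cancel, ← add_smul, ← Complex.ofReal_add] at this
  exact sub_nonneg.2 this

lemma norm_le_add_of_forall_exists_close {a : CStarMatrix (Fin n) (Fin n) A}
    {b : CStarMatrix (Fin n) (Fin n) B} (ha : IsSelfAdjoint a) (hb : IsSelfAdjoint b) {δ : ℝ}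
    (hδ : 0 ≤ δ)
    (h : ∀ Φ : A →CP CStarMatrix (Fin n) (Fin n) ℂ, Φ 1 = 1 →
      ∃ Ψ : B →CP CStarMatrix (Fin n) (Fin n) ℂ, Ψ 1 = 1 ∧
        ∀ i j r s, ‖Φ (a i j) r s - Ψ (b i j) r s‖ ≤ δ) :
    ‖a‖ ≤ ‖b‖ + (n : ℝ) ^ 4 * δ := by
  refine ha.norm_le_of_le_smul_one (by positivity) (le_smul_one_of_forall_exists_close ha hb h) ?_
  rw [← norm_neg b]
  refine le_smul_one_of_forall_exists_close ha.neg hb.neg fun Φ hΦ => ?_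
  obtain ⟨Ψ, hΨ1, hΨ⟩ := h Φ hΦ
  refine ⟨Ψ, hΨ1, fun i j r s => ?_⟩
  rw [CStarMatrix.neg_apply, CStarMatrix.neg_apply, map_neg, map_neg, CStarMatrix.neg_apply,
    CStarMatrix.neg_apply, neg_sub_neg, norm_sub_rev]
  exact hΨ i j r s

/-- Unital completely positive maps that are close on the generators are close on polynomials of
degree at most one. -/
lemma exists_norm_apply_evalStarPoly_sub_le {p : StarPoly d} (hp : p ∈ starPolyDegreeLE d 1) :
    ∃ C : ℝ, 0 ≤ C ∧ ∀ (A B : Type u) [CStarAlgebra A] [PartialOrder A] [StarOrderedRing A]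
      [CStarAlgebra B] [PartialOrder B] [StarOrderedRing B] (ξ : Fin d → A) (ζ : Fin d → B)
      (Φ : A →CP CStarMatrix (Fin n) (Fin n) ℂ) (Ψ : B →CP CStarMatrix (Fin n) (Fin n) ℂ) (ε : ℝ),
      Φ 1 = 1 → Ψ 1 = 1 → 0 ≤ ε → (∀ k i j, ‖Φ (ξ k) i j - Ψ (ζ k) i j‖ ≤ ε) →
      ∀ i j, ‖Φ (evalStarPoly ξ p) i j - Ψ (evalStarPoly ζ p) i j‖ ≤ C * ε := by
  induction hp using Submodule.span_induction with
  | mem p hp =>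
    obtain ⟨w, hw, rfl⟩ := hp
    refine ⟨1, zero_le_one, fun A B _ _ _ _ _ _ ξ ζ Φ Ψ ε hΦ hΨ hε h i j => ?_⟩
    match w, hw with
    | [], _ => simpa [hΦ, hΨ] using hε
    | [.inl k], _ => simpa [evalStarPoly] using h k i j
    | [.inr k], _ =>
      have := h k j i
      rw [← norm_star, star_sub] at this
      simpa [evalStarPoly, CompletelyPositiveMap.map_star_eq, CStarMatrix.star_apply] using this
  | zero =>
    refine ⟨0, le_rfl, fun A B _ _ _ _ _ _ ξ ζ Φ Ψ ε hΦ hΨ hε h i j => ?_⟩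
    simp
  | add p q _ _ hp hq =>
    obtain ⟨C, hC0, hC⟩ := hp
    obtain ⟨D, hD0, hD⟩ := hq
    refine ⟨C + D, add_nonneg hC0 hD0, fun A B _ _ _ _ _ _ ξ ζ Φ Ψ ε hΦ hΨ hε h i j => ?_⟩
    rw [map_add, map_add, map_add, map_add, CStarMatrix.add_apply, CStarMatrix.add_apply,
      add_sub_add_comm, add_mul]
    exact norm_add_le_of_le (hC A B ξ ζ Φ Ψ ε hΦ hΨ hε h i j) (hD A B ξ ζ Φ Ψ ε hΦ hΨ hε h i j)
  | smul c p _ hp =>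
    obtain ⟨C, hC0, hC⟩ := hp
    refine ⟨‖c‖ * C, by positivity, fun A B _ _ _ _ _ _ ξ ζ Φ Ψ ε hΦ hΨ hε h i j => ?_⟩
    rw [map_smul, map_smul, map_smul, map_smul, CStarMatrix.smul_apply, CStarMatrix.smul_apply,
      ← smul_sub, norm_smul, mul_assoc]
    exact mul_le_mul_of_nonneg_left (hC A B ξ ζ Φ Ψ ε hΦ hΨ hε h i j) (norm_nonneg c)

/-- The norm of a pencil is controlled by the matrix range of twice its size. -/
lemma exists_norm_evalMatrixStarPoly_le_add {m : ℕ} {p : Matrix (Fin m) (Fin m) (StarPoly d)}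
    (hp : ∀ i j, p i j ∈ starPolyDegreeLE d 1) :
    ∃ K : ℝ, 0 ≤ K ∧ ∀ (A B : Type u) [CStarAlgebra A] [PartialOrder A] [StarOrderedRing A]
      [CStarAlgebra B] [PartialOrder B] [StarOrderedRing B] (ξ : Fin d → A) (ζ : Fin d → B) (ε : ℝ),
      0 ≤ ε →
      (∀ X ∈ matrixRange (m + m) ξ, ∃ Y ∈ matrixRange (m + m) ζ, rowNorm (X - Y) ≤ ε) →
      ‖evalMatrixStarPoly ξ p‖ ≤ ‖evalMatrixStarPoly ζ p‖ + K * ε := by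
  choose C hC0 hC using fun i j => exists_norm_apply_evalStarPoly_sub_le.{u} (n := m + m) (hp i j)
  set S : ℝ := ∑ i, ∑ j, C i j
  have hCS : ∀ i j, C i j ≤ S := fun i j =>
    (Finset.single_le_sum (fun j _ => hC0 i j) (Finset.mem_univ j)).trans
      (Finset.single_le_sum (f := fun i => ∑ j, C i j)
        (fun i _ => Finset.sum_nonneg fun j _ => hC0 i j) (Finset.mem_univ i))
  have hS0 : 0 ≤ S := Finset.sum_nonneg fun i _ => Finset.sum_nonneg fun j _ => hC0 i j
  refine ⟨((m + m : ℕ) : ℝ) ^ 4 * S, by positivity, fun A B _ _ _ _ _ _ ξ ζ ε hε h => ?_⟩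
  rw [← norm_dilation (evalMatrixStarPoly ξ p), ← norm_dilation (evalMatrixStarPoly ζ p), mul_assoc]
  refine norm_le_add_of_forall_exists_close (isSelfAdjoint_dilation _) (isSelfAdjoint_dilation _)
    (by positivity) fun Φ hΦ => ?_
  obtain ⟨Y, ⟨Ψ, hΨ, hY⟩, hXY⟩ := h _ ⟨Φ, hΦ, fun _ => rfl⟩
  have hgen : ∀ k i j, ‖Φ (ξ k) i j - Ψ (ζ k) i j‖ ≤ ε := fun k i j => by
    rw [hY k]
    exact (norm_entry_le_rowNorm ((fun k => Φ (ξ k)) - Y) k i j).trans hXY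
  have hent : ∀ i j r s, ‖Φ (evalStarPoly ξ (p i j)) r s - Ψ (evalStarPoly ζ (p i j)) r s‖ ≤
      S * ε := fun i j r s =>
    (hC i j A B ξ ζ Φ Ψ ε hΦ hΨ hε hgen r s).trans (mul_le_mul_of_nonneg_right (hCS i j) hε)
  refine ⟨Ψ, hΨ, fun x y r s => ?_⟩
  obtain ⟨x, rfl⟩ := finSumFinEquiv.surjective x
  obtain ⟨y, rfl⟩ := finSumFinEquiv.surjective y
  rw [dilation_apply, dilation_apply]
  rcases x with i | i <;> rcases y with j | j
  · simpa [blockDilation] using mul_nonneg hS0 hε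
  · simpa [blockDilation] using hent i j r s
  · have := hent j i s r
    rw [← norm_star, star_sub] at this
    simpa [blockDilation, CompletelyPositiveMap.map_star_eq, CStarMatrix.star_apply] using this
  · simpa [blockDilation] using mul_nonneg hS0 hε

end Compare

section RangeToPencil

variable {d : ℕ} {T : Type*} [MetricSpace T] {A : T → Type u} [∀ t, CStarAlgebra (A t)]
  [∀ t, PartialOrder (A t)] [∀ t, StarOrderedRing (A t)]
  {ξ : (t : T) → Fin d → A t} {t₀ : T}

lemma MatrixRangeConvergence.pencilNormConvergence (h : MatrixRangeConvergence ξ t₀) :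
    PencilNormConvergence ξ t₀ := by
  intro m hm p hp
  obtain ⟨K, hK0, hK⟩ := exists_norm_evalMatrixStarPoly_le_add.{u} hp
  rw [Metric.tendsto_nhds]
  intro η hη
  set ε : ℝ := η / (K + 1)
  have hε : 0 < ε := by positivity
  have hKε : K * ε < η := by
    have h1 : (K + 1) * ε = η := mul_div_cancel₀ _ (by positivity)
    linarith
  filter_upwards [(h (m + m) (by omega)).eventually
    (gt_mem_nhds (ENNReal.ofReal_pos.2 hε))] with t ht
  obtain ⟨h1, h2⟩ := exists_rowNorm_lt_of_rowHausdorffDist_lt ht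
  have h3 := hK _ _ (ξ t) (ξ t₀) ε hε.le fun X hX => (h1 X hX).imp fun Y hY => ⟨hY.1, hY.2.le⟩
  have h4 := hK _ _ (ξ t₀) (ξ t) ε hε.le fun X hX => (h2 X hX).imp fun Y hY => ⟨hY.1, hY.2.le⟩
  rw [Real.dist_eq, abs_lt]
  constructor <;> linarith

end RangeToPencil

theorem mainTheorem3 (d : ℕ) {T : Type*} [MetricSpace T]
    (A : T → Type*) [∀ t, CStarAlgebra (A t)] [∀ t, PartialOrder (A t)]
    [∀ t, StarOrderedRing (A t)]
    (ξ : (t : T) → Fin d → A t) (hξ : ∀ t, GeneratesCStar (ξ t)) (t₀ : T) :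
    (ScalarNormConvergence ξ t₀ ↔ MatrixNormConvergence ξ t₀) ∧
      (MatrixNormConvergence ξ t₀ → PencilNormConvergence ξ t₀) ∧
      (PencilNormConvergence ξ t₀ ↔ MatrixRangeConvergence ξ t₀) :=
  ⟨⟨fun h => h.matrixNormConvergence, fun h => h.scalarNormConvergence⟩,
    fun h => h.pencilNormConvergence,
    ⟨fun h => h.matrixRangeConvergence, fun h => h.pencilNormConvergence⟩⟩
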